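/- Let $r>0$ and let $K=rB^2\subset\mathbb{R}^2$ be the closed disc of radius $r$ centred at the origin. For $n\ge 1$ let $x_1,\dots,x_n$ be independent random points, each uniformly distributed in $K$, and let $K_n^r$ be the intersection of all closed discs of radius $r$ that contain $\{x_1,\dots,x_n\}$. Let $f_0(K_n^r)$ be the number of vertices of $K_n^r$, that is, of the points $x\in K_n^r$ for which there are at least two different closed discs of radius $r$ that contain $K_n^r$ and have $x$ on their boundary circle, and let $A(K_n^r)$ be the area of $K_n^r$. Then there are constants $c,C,C'>0$, depending only on $r$, such that $f_0(K_n^r)$ and $A(K_n^r)$ are square-integrable random variables for every $n\ge1$ and $$\operatorname{Var} f_0(K_n^r)\le C\quad (n\ge 1),\qquad \operatorname{Var} f_0(K_n^r)\ge c\quad (n\ge 3),$$ $$\operatorname{Var} A(K_n^r)\le C'\,n^{-2}\quad (n\ge 1).$$ -/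

import Mathlib

open MeasureTheory ProbabilityTheory

/-- The Euclidean plane. -/
abbrev Plane : Type := EuclideanSpace ℝ (Fin 2)

/-- The closed `r`-hyperconvex hull of `X`: the intersection of all closed circular discs of
radius `r` that contain `X`. -/
def rHull (r : ℝ) (X : Set Plane) : Set Plane :=
  ⋂ p ∈ {p : Plane | X ⊆ Metric.closedBall p r}, Metric.closedBall p r

/-- The closed disc of radius `r` centred at `p` supports `S` at `x`: it contains `S`, and `x` is a
point of `S` on the bounding circle. -/
def SupportsAt (r : ℝ) (S : Set Plane) (p x : Plane) : Prop :=
  S ⊆ Metric.closedBall p r ∧ x ∈ S ∧ dist x p = r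

/-- The vertices of a disc-polygon `S` of radius `r`: the corner points of `S`, where at least two
different discs of radius `r` support `S`. (At a relative interior point of an edge, the disc of
that edge is the only one.) -/
def rVertices (r : ℝ) (S : Set Plane) : Set Plane :=
  {x | ∃ p q : Plane, p ≠ q ∧ SupportsAt r S p x ∧ SupportsAt r S q x}

/-- The random disc-polygon spanned by the sample `x₁, …, xₙ`. -/
def discPolygon (r : ℝ) {n : ℕ} (x : Fin n → Plane) : Set Plane :=
  rHull r (Set.range x)

/-- The number of vertices of the disc-polygon spanned by a sample. -/
noncomputable def vertexNumber (r : ℝ) {n : ℕ} (x : Fin n → Plane) : ℝ :=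
  ((rVertices r (discPolygon r x)).ncard : ℝ)

/-- The area of the disc-polygon spanned by a sample. -/
noncomputable def polygonArea (r : ℝ) {n : ℕ} (x : Fin n → Plane) : ℝ :=
  (volume (discPolygon r x)).toReal

/-- The joint law of `n` independent random points, each uniformly distributed in `K`. -/
noncomputable def uniformSample (K : Set Plane) (n : ℕ) : Measure (Fin n → Plane) :=
  Measure.pi fun _ => ProbabilityTheory.cond (volume : Measure Plane) K

/-! The disc-polygon is the intersection of the discs of radius r about the set of centres `centers
r x`. As K itself has radius r, the origin is a centre for every sample in K, and everything depends
on how far from it the other centres lie. A disc displaced by p misses a crescent of K, and this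
crescent contains the part of thickness ‖p‖/8 of one of three fixed sectors
(`exists_norm_le_of_mem_centers`). A centre at distance q r/n thus forces a region of mass of order
q/n to be empty, an event of probability at most 3 exp(-βq). The centres therefore stay within
O(1/n) of the origin, with an exponential tail.

If all centres have norm at most ur, the area deficit is at most 2u times the area of K, so its
second moment is O(n⁻²). A vertex at depth t below the circle has a centre of norm at least t, so
two given points are both vertices with probability O(n⁻²). Summing over the pairs bounds the second
moment of the vertex number.

For the lower bound, `cornerConfig` places k points very near the circle and all others deeper, with
probability bounded below. Three such points allow at most three vertices, four of them force at
least four. Two values a unit apart, each side with probability bounded below, keep the variance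
away from zero. -/

/-! ### Centres and vertices of a disc-polygon -/

/-- The centres of the discs of radius `r` that contain the sample. -/
def centers (r : ℝ) {n : ℕ} (x : Fin n → Plane) : Set Plane := {p | ∀ i, dist (x i) p ≤ r}

theorem mem_discPolygon {r : ℝ} {n : ℕ} {x : Fin n → Plane} {y : Plane} :
    y ∈ discPolygon r x ↔ ∀ p ∈ centers r x, dist y p ≤ r := by
  simp [discPolygon, rHull, centers, Set.range_subset_iff]

theorem mem_discPolygon_self {r : ℝ} {n : ℕ} (x : Fin n → Plane) (i : Fin n) :
    x i ∈ discPolygon r x :=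
  mem_discPolygon.2 fun _ hp => hp i

theorem supportsAt_discPolygon {r : ℝ} {n : ℕ} {x : Fin n → Plane} {p y : Plane} :
    SupportsAt r (discPolygon r x) p y ↔
      p ∈ centers r x ∧ y ∈ discPolygon r x ∧ dist y p = r := by
  refine and_congr ⟨fun h i => h (mem_discPolygon_self x i), fun hp y hy => ?_⟩ Iff.rfl
  exact mem_discPolygon.1 hy p hp

/-- The `i`-th sample point lies on the boundary of two different containing discs. -/
def IsVertexIndex (r : ℝ) {n : ℕ} (x : Fin n → Plane) (i : Fin n) : Prop :=
  ∃ p q : Plane, p ≠ q ∧ p ∈ centers r x ∧ q ∈ centers r x ∧ dist (x i) p = r ∧ dist (x i) q = r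

theorem inner_le_of_norm_sub_le {r : ℝ} {P w : Plane} (hP : ‖P‖ = r) (h : ‖w - P‖ ≤ r) :
    ‖w‖ ^ 2 ≤ 2 * inner ℝ P w := by
  have h1 := norm_sub_sq_real w P
  have h2 : ‖w - P‖ ^ 2 ≤ r ^ 2 := pow_le_pow_left₀ (norm_nonneg _) h 2
  rw [real_inner_comm, hP] at h1
  linarith

/-- Every vertex of a disc-polygon is a sample point. -/
theorem exists_eq_of_mem_rVertices {r : ℝ} (hr : 0 < r) {n : ℕ} (hn : 0 < n)
    {x : Fin n → Plane} {y : Plane} (hy : y ∈ rVertices r (discPolygon r x)) :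
    ∃ i, x i = y := by
  obtain ⟨p, q, hpq, hp, hq⟩ := hy
  obtain ⟨hp, hyh, hyp⟩ := supportsAt_discPolygon.1 hp
  obtain ⟨hq, -, hyq⟩ := supportsAt_discPolygon.1 hq
  by_contra! hne
  have hP : ‖p - y‖ = r := by rw [← dist_eq_norm, dist_comm, hyp]
  have hQ : ‖q - y‖ = r := by rw [← dist_eq_norm, dist_comm, hyq]
  have hiP : ∀ i, ‖x i - y‖ ^ 2 ≤ 2 * inner ℝ (p - y) (x i - y) := fun i =>
    inner_le_of_norm_sub_le hP (by simpa [dist_eq_norm] using hp i)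
  have hiQ : ∀ i, ‖x i - y‖ ^ 2 ≤ 2 * inner ℝ (q - y) (x i - y) := fun i =>
    inner_le_of_norm_sub_le hQ (by simpa [dist_eq_norm] using hq i)
  have hpos : ∀ i, 0 < ‖x i - y‖ ^ 2 := fun i => by
    have : 0 < ‖x i - y‖ := norm_pos_iff.2 (sub_ne_zero.2 (hne i))
    positivity
  set S := (p - y) + (q - y) with hS
  have hiS : ∀ i, ‖x i - y‖ ^ 2 ≤ inner ℝ S (x i - y) := fun i => by
    rw [hS, inner_add_left]; linarith [hiP i, hiQ i]
  have hS0 : 0 < ‖S‖ := by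
    refine norm_pos_iff.2 fun h => ?_
    have := hiS ⟨0, hn⟩
    rw [h, inner_zero_left] at this
    linarith [hpos ⟨0, hn⟩]
  -- S / 2 is the midpoint of two different vectors of length r, hence shorter than r. Stretching it
  -- to length r makes the inequalities `hiS` strict.
  have hS2 : ‖S‖ < 2 * r := by
    have h1 := parallelogram_law_with_norm ℝ (p - y) (q - y)
    have h2 : 0 < ‖(p - y) - (q - y)‖ := by
      rw [sub_sub_sub_cancel_right]; exact norm_pos_iff.2 (sub_ne_zero.2 hpq)
    rw [← hS, hP, hQ] at h1
    nlinarith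
  -- the midpoint `y + Z` of the arc from `p` to `q` is an interior point of all other discs
  set Z : Plane := (r / ‖S‖) • S with hZ
  have hZn : ‖Z‖ = r := by
    rw [hZ, norm_smul, Real.norm_of_nonneg (by positivity), div_mul_cancel₀ _ hS0.ne']
  have hlt : ∀ i, dist (x i) (y + Z) < r := fun i => by
    have h1 : ‖x i - y‖ ^ 2 < 2 * inner ℝ Z (x i - y) := by
      rw [hZ, real_inner_smul_left]
      have h2 : 1 / 2 < r / ‖S‖ := by rw [div_lt_div_iff₀ (by norm_num) hS0]; linarith
      nlinarith [hpos i, hiS i]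
    have h3 := norm_sub_sq_real (x i - y) Z
    rw [real_inner_comm, hZn] at h3
    have h4 : ‖x i - y - Z‖ ^ 2 < r ^ 2 := by linarith
    rw [dist_eq_norm, ← sub_sub]
    exact lt_of_pow_lt_pow_left₀ 2 hr.le h4
  -- Moving the centre a little beyond y + Z keeps the sample covered but leaves y outside, so y is
  -- not in the hull.
  have hev : ∀ᶠ t : ℝ in nhdsWithin 1 (Set.Ioi 1), ∀ i, dist (x i) (y + t • Z) < r := by
    refine Filter.Eventually.filter_mono nhdsWithin_le_nhds (Filter.eventually_all.2 fun i => ?_)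
    have hc : Continuous fun t : ℝ => dist (x i) (y + t • Z) := by fun_prop
    exact hc.continuousAt.eventually_lt continuousAt_const (by simpa using hlt i)
  obtain ⟨t, ht, ht1⟩ := (hev.and self_mem_nhdsWithin).exists
  have h5 := mem_discPolygon.1 hyh (y + t • Z) fun i => (ht i).le
  rw [dist_self_add_right, norm_smul, hZn, Real.norm_of_nonneg (by linarith [(show (1 : ℝ) < t from ht1)])] at h5
  nlinarith [(show (1 : ℝ) < t from ht1)]

theorem rVertices_discPolygon {r : ℝ} (hr : 0 < r) {n : ℕ} (hn : 0 < n) (x : Fin n → Plane) :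
    rVertices r (discPolygon r x) = x '' {i | IsVertexIndex r x i} := by
  ext y
  constructor
  · intro hy
    obtain ⟨i, rfl⟩ := exists_eq_of_mem_rVertices hr hn hy
    obtain ⟨p, q, hpq, hp, hq⟩ := hy
    obtain ⟨hp, -, hyp⟩ := supportsAt_discPolygon.1 hp
    obtain ⟨hq, -, hyq⟩ := supportsAt_discPolygon.1 hq
    exact ⟨i, ⟨p, q, hpq, hp, hq, hyp, hyq⟩, rfl⟩
  · rintro ⟨i, ⟨p, q, hpq, hp, hq, hyp, hyq⟩, rfl⟩
    exact ⟨p, q, hpq, supportsAt_discPolygon.2 ⟨hp, mem_discPolygon_self x i, hyp⟩,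
      supportsAt_discPolygon.2 ⟨hq, mem_discPolygon_self x i, hyq⟩⟩

theorem vertexNumber_le_of_forall_mem {r : ℝ} (hr : 0 < r) {n : ℕ} (hn : 0 < n)
    {x : Fin n → Plane} {T : Finset (Fin n)} (h : ∀ i, IsVertexIndex r x i → i ∈ T) :
    vertexNumber r x ≤ T.card := by
  rw [vertexNumber, rVertices_discPolygon hr hn]
  have h1 : x '' {i | IsVertexIndex r x i} ⊆ x '' (T : Set (Fin n)) :=
    Set.image_mono fun i hi => h i hi
  have h2 := (Set.ncard_le_ncard h1 (Set.toFinite _)).trans (Set.ncard_image_le (Set.toFinite _))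
  rw [Set.ncard_coe_finset] at h2
  exact_mod_cast h2

theorem vertexNumber_nonneg (r : ℝ) {n : ℕ} (x : Fin n → Plane) : 0 ≤ vertexNumber r x :=
  Nat.cast_nonneg _

theorem vertexNumber_le {r : ℝ} (hr : 0 < r) {n : ℕ} (hn : 0 < n) (x : Fin n → Plane) :
    vertexNumber r x ≤ n := by
  simpa using vertexNumber_le_of_forall_mem hr hn (x := x) (T := Finset.univ) (by simp)

theorem le_vertexNumber {r : ℝ} (hr : 0 < r) {n k : ℕ} (hn : 0 < n) {x : Fin n → Plane}
    (σ : Fin k → Fin n) (hinj : Function.Injective fun j => x (σ j))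
    (h : ∀ j, IsVertexIndex r x (σ j)) : (k : ℝ) ≤ vertexNumber r x := by
  rw [vertexNumber, rVertices_discPolygon hr hn]
  have h1 : Set.range (fun j => x (σ j)) ⊆ x '' {i | IsVertexIndex r x i} := by
    rintro _ ⟨j, rfl⟩
    exact ⟨σ j, h j, rfl⟩
  have h2 := Set.ncard_le_ncard h1 (Set.toFinite _)
  rw [← Set.image_univ, Set.ncard_image_of_injective _ hinj, Set.ncard_univ] at h2
  simp only [Nat.card_eq_fintype_card, Fintype.card_fin] at h2
  exact_mod_cast h2

/-- A sample point is a vertex if some disc of radius `r` has it on its boundary and all the other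
sample points in its interior. -/
theorem isVertexIndex_of_forall_lt {r : ℝ} (hr : 0 < r) {n : ℕ} {x : Fin n → Plane} {i : Fin n}
    {p : Plane} (hp : dist (x i) p = r) (h : ∀ j, j ≠ i → dist (x j) p < r) :
    IsVertexIndex r x i := by
  set P : Plane := p - x i with hP
  have hPn : ‖P‖ = r := by rw [hP, ← dist_eq_norm, dist_comm, hp]
  set J : Plane := !₂[-P 1, P 0] with hJ
  have hPJ : inner ℝ P J = 0 := by
    simp [hJ, PiLp.inner_apply, Fin.sum_univ_two]; ring
  have hJn : ‖J‖ ^ 2 = r ^ 2 := by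
    rw [← hPn]; simp [hJ, EuclideanSpace.norm_sq_eq, Fin.sum_univ_two]; ring
  -- The second disc is the first one rotated about x i by a small angle θ: x i stays on the circle
  -- and the strict inequalities survive.
  set q : ℝ → Plane := fun θ => x i + (Real.cos θ • P + Real.sin θ • J) with hq
  have hq0 : q 0 = p := by simp [hq, hP]
  have hqn : ∀ θ, dist (x i) (q θ) = r := fun θ => by
    have h1 : ‖Real.cos θ • P + Real.sin θ • J‖ ^ 2 = r ^ 2 := by
      rw [norm_add_sq_real, norm_smul, norm_smul, real_inner_smul_left, real_inner_smul_right, hPJ,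
        mul_pow, mul_pow, hJn, hPn, Real.norm_eq_abs, Real.norm_eq_abs, sq_abs, sq_abs]
      linear_combination r ^ 2 * Real.cos_sq_add_sin_sq θ
    rw [hq, dist_self_add_right]
    exact (pow_left_inj₀ (norm_nonneg _) hr.le two_ne_zero).1 h1
  have hev : ∀ᶠ θ : ℝ in nhdsWithin 0 (Set.Ioi 0), θ < Real.pi ∧ ∀ j, dist (x j) (q θ) ≤ r := by
    refine Filter.Eventually.filter_mono nhdsWithin_le_nhds
      ((eventually_lt_nhds Real.pi_pos).and (Filter.eventually_all.2 fun j => ?_))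
    by_cases hj : j = i
    · exact Filter.Eventually.of_forall fun θ => by rw [hj, hqn]
    · have hc : Continuous fun θ : ℝ => dist (x j) (q θ) := by
        have := Real.continuous_cos
        have := Real.continuous_sin
        fun_prop
      filter_upwards [hc.continuousAt.eventually_lt (continuousAt_const (y := r))
        (by simpa [hq0] using h j hj)] with θ hθ using hθ.le
  obtain ⟨θ, ⟨hθ, hc⟩, hθ0⟩ := (hev.and self_mem_nhdsWithin).exists
  refine ⟨p, q θ, fun hpq => ?_, fun j => ?_, hc, hp, hqn θ⟩
  · have h1 : P = Real.cos θ • P + Real.sin θ • J := sub_eq_iff_eq_add'.2 hpq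
    have h2 : inner ℝ P J = inner ℝ (Real.cos θ • P + Real.sin θ • J) J := by rw [← h1]
    rw [inner_add_left, real_inner_smul_left, real_inner_smul_left, hPJ,
      real_inner_self_eq_norm_sq, hJn] at h2
    have := Real.sin_pos_of_pos_of_lt_pi hθ0 hθ
    have : 0 < Real.sin θ * r ^ 2 := by positivity
    linarith
  · by_cases hj : j = i
    · rw [hj, hp]
    · exact (h j hj).le

/-! ### Three cones and the crescent missed by a displaced disc -/

/-- The points whose direction is close to `v`. -/
def cone (v : Plane) : Set Plane := {y | ‖y - ‖y‖ • v‖ ≤ ‖y‖ / 8}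

theorem inner_le_of_mem_cone {v y : Plane} (hy : y ∈ cone v) (p : Plane) :
    inner ℝ y p ≤ ‖y‖ * ‖p‖ / 8 + ‖y‖ * inner ℝ v p := by
  have h1 : inner ℝ y p = inner ℝ (y - ‖y‖ • v) p + ‖y‖ * inner ℝ v p := by
    rw [inner_sub_left, real_inner_smul_left]; ring
  have h2 : inner ℝ (y - ‖y‖ • v) p ≤ ‖y‖ / 8 * ‖p‖ :=
    (real_inner_le_norm _ _).trans (mul_le_mul_of_nonneg_right hy (norm_nonneg _))
  linarith

/-- Three unit vectors that positively span the plane. -/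
noncomputable def triangleDirection : Fin 3 → Plane :=
  ![!₂[0, 1], !₂[4 / 5, -(3 / 5)], !₂[-(4 / 5), -(3 / 5)]]

theorem exists_inner_triangleDirection_le (p : Plane) :
    ∃ j, inner ℝ (triangleDirection j) p ≤ -(1 / 4) * ‖p‖ := by
  have hn : ‖p‖ ^ 2 = p 0 ^ 2 + p 1 ^ 2 := by
    simp [EuclideanSpace.norm_sq_eq, Fin.sum_univ_two]
  have h0 := norm_nonneg p
  by_contra! h
  have h1 := h 0
  have h2 := h 1
  have h3 := h 2
  simp [triangleDirection, PiLp.inner_apply, Fin.sum_univ_two] at h1 h2 h3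
  nlinarith

/-- Of the factor -1/4 for the best direction, the opening of the cone costs 1/8, so ⟨y, p⟩ ≤
-‖y‖‖p‖/8 and dist y p ≥ ‖y‖ + ‖p‖/8. -/
theorem lt_dist_of_mem_cone {r : ℝ} (p : Plane) :
    ∃ j, ∀ y ∈ cone (triangleDirection j), r - ‖p‖ / 8 < ‖y‖ → r < dist y p := by
  obtain ⟨j, hj⟩ := exists_inner_triangleDirection_le p
  refine ⟨j, fun y hy hlt => ?_⟩
  have h1 := inner_le_of_mem_cone hy p
  have h2 : ‖y‖ * inner ℝ (triangleDirection j) p ≤ ‖y‖ * (-(1 / 4) * ‖p‖) :=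
    mul_le_mul_of_nonneg_left hj (norm_nonneg _)
  have h3 := norm_sub_sq_real y p
  have h4 : (‖y‖ + ‖p‖ / 8) ^ 2 ≤ ‖y - p‖ ^ 2 := by nlinarith [sq_nonneg ‖p‖]
  have h5 := le_of_sq_le_sq h4 (norm_nonneg _)
  rw [dist_eq_norm]
  linarith

/-! ### Measurability of the vertex number and the area -/

theorem isClosed_setOf_exists_of_compactSpace {X Y : Type*} [TopologicalSpace X]
    [TopologicalSpace Y] [CompactSpace Y] {s : Set (X × Y)} (hs : IsClosed s) :
    IsClosed {x | ∃ y, (x, y) ∈ s} := by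
  have h := isClosedMap_fst_of_compactSpace (X := X) (Y := Y) s hs
  convert h using 1
  ext x
  simp

/-- The centres range over a compact circle about x i, so eliminating them is a projection along a
compact factor, which keeps sets closed. The open condition p ≠ q is exhausted by the closed ones
with distance at least 1/(m+1). -/
theorem measurableSet_isVertexIndex (r : ℝ) {n : ℕ} (i : Fin n) :
    MeasurableSet {x : Fin n → Plane | IsVertexIndex r x i} := by
  have hset : {x : Fin n → Plane | IsVertexIndex r x i} =
      ⋃ m : ℕ, {x | ∃ z : Metric.sphere (0 : Plane) r × Metric.sphere (0 : Plane) r,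
        (x, z) ∈ {w : (Fin n → Plane) × (Metric.sphere (0 : Plane) r × Metric.sphere (0 : Plane) r) |
          1 / ((m : ℝ) + 1) ≤ dist (w.2.1 : Plane) w.2.2 ∧
          ∀ j, dist (w.1 j) (w.1 i + w.2.1) ≤ r ∧ dist (w.1 j) (w.1 i + w.2.2) ≤ r}} := by
    ext x
    simp only [Set.mem_ofPred_eq, Set.mem_iUnion]
    constructor
    · rintro ⟨p, q, hpq, hp, hq, hip, hiq⟩
      obtain ⟨m, hm⟩ := exists_nat_one_div_lt (dist_pos.2 hpq)
      refine ⟨m, ⟨⟨p - x i, ?_⟩, ⟨q - x i, ?_⟩⟩, ?_, fun j => ⟨?_, ?_⟩⟩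
      · rw [mem_sphere_zero_iff_norm, ← dist_eq_norm, dist_comm, hip]
      · rw [mem_sphere_zero_iff_norm, ← dist_eq_norm, dist_comm, hiq]
      · simpa using hm.le
      · simpa using hp j
      · simpa using hq j
    · rintro ⟨m, ⟨⟨P, hP⟩, ⟨Q, hQ⟩⟩, hd, h⟩
      refine ⟨x i + P, x i + Q, fun he => ?_, fun j => (h j).1, fun j => (h j).2, ?_, ?_⟩
      · have : P = Q := by simpa using he
        simp only [this, dist_self] at hd
        have : 0 < 1 / ((m : ℝ) + 1) := by positivity
        linarith
      · simpa using hP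
      · simpa using hQ
  rw [hset]
  refine MeasurableSet.iUnion fun m => (isClosed_setOf_exists_of_compactSpace ?_).measurableSet
  have hd : Continuous fun w : (Fin n → Plane) ×
      (Metric.sphere (0 : Plane) r × Metric.sphere (0 : Plane) r) =>
      dist (w.2.1 : Plane) w.2.2 := by fun_prop
  simp only [Set.ofPred_and, Set.ofPred_forall]
  refine (isClosed_le continuous_const hd).inter (isClosed_iInter fun j => ?_)
  exact (isClosed_le (by fun_prop) continuous_const).inter
    (isClosed_le (by fun_prop) continuous_const)

-- Sample points may coincide; each vertex is counted at its smallest index.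
open Classical in
theorem vertexNumber_eq_card {r : ℝ} (hr : 0 < r) {n : ℕ} (hn : 0 < n) (x : Fin n → Plane) :
    vertexNumber r x =
      ∑ i, if IsVertexIndex r x i ∧ ∀ j < i, x j ≠ x i then (1 : ℝ) else 0 := by
  have himg : x '' {i | IsVertexIndex r x i} =
      x '' ((Finset.univ.filter fun i => IsVertexIndex r x i ∧ ∀ j < i, x j ≠ x i :
        Finset (Fin n)) : Set (Fin n)) := by
    ext y
    constructor
    · rintro ⟨i, hi, rfl⟩
      let T : Finset (Fin n) := Finset.univ.filter fun k => x k = x i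
      have hT : T.Nonempty := ⟨i, by simp [T]⟩
      have hm : x (T.min' hT) = x i := (Finset.mem_filter.1 (T.min'_mem hT)).2
      refine ⟨T.min' hT, ?_, hm⟩
      simp only [Finset.coe_filter, Finset.mem_univ, true_and, Set.mem_ofPred_eq]
      refine ⟨?_, fun j hj hji => ?_⟩
      · unfold IsVertexIndex
        rw [hm]
        exact hi
      · exact absurd (T.min'_le j (by simp [T, hji, hm])) (not_le.2 hj)
    · rintro ⟨i, hi, rfl⟩
      simp only [Finset.coe_filter, Finset.mem_univ, true_and, Set.mem_ofPred_eq] at hi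
      exact ⟨i, hi.1, rfl⟩
  rw [vertexNumber, rVertices_discPolygon hr hn, himg, Set.InjOn.ncard_image,
    Set.ncard_coe_finset, Finset.sum_boole]
  intro i hi k hk hik
  simp only [Finset.coe_filter, Finset.mem_univ, true_and, Set.mem_ofPred_eq] at hi hk
  rcases lt_trichotomy i k with h | h | h
  · exact absurd hik (hk.2 i h)
  · exact h
  · exact absurd hik.symm (hi.2 k h)

theorem measurable_vertexNumber {r : ℝ} (hr : 0 < r) {n : ℕ} (hn : 0 < n) :
    Measurable (vertexNumber r : (Fin n → Plane) → ℝ) := by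
  classical
  have : (vertexNumber r : (Fin n → Plane) → ℝ) = fun x =>
      ∑ i, if IsVertexIndex r x i ∧ ∀ j < i, x j ≠ x i then (1 : ℝ) else 0 :=
    funext fun x => vertexNumber_eq_card hr hn x
  rw [this]
  refine Finset.measurable_fun_sum _ fun i _ => Measurable.ite ?_ measurable_const measurable_const
  simp only [Set.ofPred_and, Set.ofPred_forall]
  refine (measurableSet_isVertexIndex r i).inter ?_
  refine MeasurableSet.iInter fun j => MeasurableSet.iInter fun _ => ?_
  exact (measurableSet_eq_fun (measurable_pi_apply j) (measurable_pi_apply i)).compl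

/-- The complement is again a countable union of projections along a compact factor. Joint
measurability makes the area of the sections measurable. -/
theorem measurableSet_graph_discPolygon (r : ℝ) {n : ℕ} (hn : 0 < n) :
    MeasurableSet {z : (Fin n → Plane) × Plane | z.2 ∈ discPolygon r z.1} := by
  have hset : {z : (Fin n → Plane) × Plane | z.2 ∈ discPolygon r z.1}ᶜ =
      ⋃ m : ℕ, {z | ∃ P : Metric.closedBall (0 : Plane) r,
        (z, P) ∈ {w : ((Fin n → Plane) × Plane) × Metric.closedBall (0 : Plane) r |
          r + 1 / ((m : ℝ) + 1) ≤ dist w.1.2 (w.1.1 ⟨0, hn⟩ + w.2) ∧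
          ∀ j, dist (w.1.1 j) (w.1.1 ⟨0, hn⟩ + w.2) ≤ r}} := by
    ext ⟨x, y⟩
    simp only [Set.mem_ofPred_eq, Set.mem_iUnion, Set.mem_compl_iff, mem_discPolygon, not_forall,
      not_le]
    constructor
    · rintro ⟨p, hp, hlt⟩
      obtain ⟨m, hm⟩ := exists_nat_one_div_lt (sub_pos.2 hlt)
      refine ⟨m, ⟨p - x ⟨0, hn⟩, ?_⟩, ?_, fun j => ?_⟩
      · rw [mem_closedBall_zero_iff, ← dist_eq_norm, dist_comm]
        exact hp _
      · simp only [add_sub_cancel]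
        linarith
      · simpa using hp j
    · rintro ⟨m, ⟨P, hP⟩, hd, h⟩
      refine ⟨x ⟨0, hn⟩ + P, h, lt_of_lt_of_le ?_ hd⟩
      have : 0 < 1 / ((m : ℝ) + 1) := by positivity
      linarith
  rw [← MeasurableSet.compl_iff, hset]
  refine MeasurableSet.iUnion fun m => (isClosed_setOf_exists_of_compactSpace ?_).measurableSet
  simp only [Set.ofPred_and, Set.ofPred_forall]
  refine (isClosed_le continuous_const (by fun_prop)).inter ?_
  exact isClosed_iInter fun j => isClosed_le (by fun_prop) continuous_const

theorem measurable_polygonArea (r : ℝ) {n : ℕ} (hn : 0 < n) :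
    Measurable (polygonArea r : (Fin n → Plane) → ℝ) :=
  (measurable_measure_prodMk_left (measurableSet_graph_discPolygon r hn)).ennreal_toReal

/-! ### Masses of discs and cone sectors -/

/-- The uniform distribution on the disc of radius `r`. -/
noncomputable def discLaw (r : ℝ) : Measure Plane :=
  ProbabilityTheory.cond (volume : Measure Plane) (Metric.closedBall 0 r)

theorem isProbabilityMeasure_discLaw {r : ℝ} (hr : 0 < r) : IsProbabilityMeasure (discLaw r) :=
  cond_isProbabilityMeasure_of_finite (Metric.measure_closedBall_pos _ _ hr).ne'
    measure_closedBall_lt_top.ne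

theorem isProbabilityMeasure_uniformSample {r : ℝ} (hr : 0 < r) (n : ℕ) :
    IsProbabilityMeasure (uniformSample (Metric.closedBall (0 : Plane) r) n) := by
  have := isProbabilityMeasure_discLaw hr
  exact inferInstanceAs (IsProbabilityMeasure (Measure.pi fun _ : Fin n => discLaw r))

theorem uniformSample_real_pi {r : ℝ} (hr : 0 < r) {n : ℕ} (s : Fin n → Set Plane) :
    (uniformSample (Metric.closedBall (0 : Plane) r) n).real (Set.univ.pi s) =
      ∏ i, (discLaw r).real (s i) := by
  have := isProbabilityMeasure_discLaw hr
  change (Measure.pi fun _ : Fin n => discLaw r).real (Set.univ.pi s) = _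
  rw [measureReal_def, Measure.pi_pi, ENNReal.toReal_prod]
  rfl

theorem ae_norm_le_uniformSample {r : ℝ} (hr : 0 < r) (n : ℕ) :
    ∀ᵐ x ∂uniformSample (Metric.closedBall (0 : Plane) r) n, ∀ i, ‖x i‖ ≤ r := by
  have := isProbabilityMeasure_discLaw hr
  have h : ∀ᵐ y ∂discLaw r, ‖y‖ ≤ r := by
    filter_upwards [ae_cond_mem (μ := (volume : Measure Plane)) (s := Metric.closedBall 0 r)
      Metric.isClosed_closedBall.measurableSet] with y hy using mem_closedBall_zero_iff.1 hy
  exact ae_all_iff.2 fun i =>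
    (Measure.quasiMeasurePreserving_eval (fun _ : Fin n => discLaw r) i).ae h

theorem discLaw_real_of_subset {r : ℝ} {s : Set Plane} (hs : s ⊆ Metric.closedBall 0 r) :
    (discLaw r).real s = volume.real s / volume.real (Metric.closedBall (0 : Plane) r) := by
  rw [measureReal_def, discLaw, cond_apply Metric.isClosed_closedBall.measurableSet,
    Set.inter_eq_right.2 hs, ENNReal.toReal_mul, ENNReal.toReal_inv, measureReal_def,
    measureReal_def, mul_comm, div_eq_mul_inv]

theorem volume_real_closedBall (p : Plane) {r : ℝ} (hr : 0 ≤ r) :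
    volume.real (Metric.closedBall p r) = r ^ 2 * volume.real (Metric.closedBall (0 : Plane) 1) := by
  rw [Measure.addHaar_real_closedBall' _ _ hr, finrank_euclideanSpace_fin]

theorem volume_real_unitBall_pos : 0 < volume.real (Metric.closedBall (0 : Plane) 1) :=
  ENNReal.toReal_pos (Metric.measure_closedBall_pos _ _ one_pos).ne' measure_closedBall_lt_top.ne

theorem discLaw_real_closedBall {r ρ : ℝ} (hρ : 0 ≤ ρ) (hr : 0 < r) (h : ρ ≤ r) :
    (discLaw r).real (Metric.closedBall 0 ρ) = (ρ / r) ^ 2 := by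
  rw [discLaw_real_of_subset (Metric.closedBall_subset_closedBall h), volume_real_closedBall _ hρ,
    volume_real_closedBall _ hr.le]
  have := volume_real_unitBall_pos
  field_simp

theorem one_sub_le_discLaw_real_closedBall {r t : ℝ} (hr : 0 < r) (ht : 0 ≤ t) :
    1 - 2 * t / r ≤ (discLaw r).real (Metric.closedBall 0 (r - t)) := by
  rcases le_or_gt t r with h | h
  · rw [discLaw_real_closedBall (by linarith) hr (by linarith), sub_div, div_self hr.ne',
      mul_div_assoc]
    nlinarith [sq_nonneg (t / r)]
  · have : 1 < t / r := (one_lt_div hr).2 h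
    refine le_trans ?_ measureReal_nonneg
    rw [mul_div_assoc]
    linarith

theorem discLaw_real_compl_closedBall_le {r t : ℝ} (hr : 0 < r) (ht : 0 ≤ t) :
    (discLaw r).real (Metric.closedBall 0 (r - t))ᶜ ≤ 2 * t / r := by
  have := isProbabilityMeasure_discLaw hr
  rw [probReal_compl_eq_one_sub Metric.isClosed_closedBall.measurableSet]
  linarith [one_sub_le_discLaw_real_closedBall hr ht]

/-- The points of the cone around `v` at distance more than `a` and at most `b` from the apex. -/
def coneSector (v : Plane) (a b : ℝ) : Set Plane := {y | y ∈ cone v ∧ a < ‖y‖ ∧ ‖y‖ ≤ b}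

theorem measurableSet_cone (v : Plane) : MeasurableSet (cone v) :=
  measurableSet_le (f := fun y : Plane => ‖y - ‖y‖ • v‖) (g := fun y => ‖y‖ / 8)
    (by fun_prop) (by fun_prop)

theorem measurableSet_coneSector (v : Plane) (a b : ℝ) : MeasurableSet (coneSector v a b) :=
  (measurableSet_cone v).inter
    ((measurableSet_lt measurable_const measurable_norm).inter
      (measurableSet_le measurable_norm measurable_const))

open scoped Pointwise in
theorem cone_inter_closedBall (v : Plane) {ρ : ℝ} (hρ : 0 < ρ) :
    cone v ∩ Metric.closedBall 0 ρ = ρ • (cone v ∩ Metric.closedBall 0 1) := by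
  ext y
  rw [Set.mem_smul_set_iff_inv_smul_mem₀ hρ.ne']
  have h1 : ‖ρ⁻¹ • y‖ = ρ⁻¹ * ‖y‖ := by
    rw [norm_smul, Real.norm_of_nonneg (by positivity)]
  have h2 : ‖ρ⁻¹ • y - (ρ⁻¹ * ‖y‖) • v‖ = ρ⁻¹ * ‖y - ‖y‖ • v‖ := by
    rw [mul_smul, ← smul_sub, norm_smul, Real.norm_of_nonneg (by positivity)]
  have h3 : ρ⁻¹ * ‖y‖ ≤ 1 ↔ ‖y‖ ≤ ρ := by rw [inv_mul_le_iff₀ hρ, mul_one]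
  have h4 : ρ⁻¹ * ‖y - ‖y‖ • v‖ ≤ ρ⁻¹ * ‖y‖ / 8 ↔ ‖y - ‖y‖ • v‖ ≤ ‖y‖ / 8 := by
    rw [mul_div_assoc, mul_le_mul_iff_right₀ (by positivity)]
  simp only [cone, Set.mem_inter_iff, Set.mem_ofPred_eq, mem_closedBall_zero_iff, h1, h2, h3, h4]

theorem volume_real_cone_inter_closedBall (v : Plane) {ρ : ℝ} (hρ : 0 < ρ) :
    volume.real (cone v ∩ Metric.closedBall 0 ρ) =
      ρ ^ 2 * volume.real (cone v ∩ Metric.closedBall 0 1) := by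
  rw [cone_inter_closedBall v hρ, measureReal_def, Measure.addHaar_smul, ENNReal.toReal_mul,
    finrank_euclideanSpace_fin, abs_of_nonneg (by positivity),
    ENNReal.toReal_ofReal (by positivity), measureReal_def]

/-- The proportion of the disc that the cone around `v` covers. -/
noncomputable def coneFraction (v : Plane) : ℝ :=
  volume.real (cone v ∩ Metric.closedBall 0 1) / volume.real (Metric.closedBall (0 : Plane) 1)

theorem coneFraction_pos {v : Plane} (hv : ‖v‖ = 1) : 0 < coneFraction v := by
  refine div_pos (ENNReal.toReal_pos ?_ ?_) volume_real_unitBall_pos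
  · refine ne_of_gt (lt_of_lt_of_le (IsOpen.measure_pos volume
      (U := {y : Plane | ‖y - ‖y‖ • v‖ < ‖y‖ / 8 ∧ ‖y‖ < 1}) ?_ ?_) (measure_mono ?_))
    · exact (isOpen_lt (f := fun y : Plane => ‖y - ‖y‖ • v‖) (g := fun y => ‖y‖ / 8)
        (by fun_prop) (by fun_prop)).inter (isOpen_lt continuous_norm continuous_const)
    · refine ⟨(1 / 2 : ℝ) • v, ?_⟩
      have : ‖(1 / 2 : ℝ) • v‖ = 1 / 2 := by rw [norm_smul, hv]; norm_num
      simp only [Set.mem_ofPred_eq, this, sub_self, norm_zero]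
      norm_num
    · rintro y ⟨h1, h2⟩
      exact ⟨h1.le, mem_closedBall_zero_iff.2 h2.le⟩
  · exact measure_ne_top_of_subset Set.inter_subset_right measure_closedBall_lt_top.ne

theorem discLaw_real_coneSector (v : Plane) {r a b : ℝ} (ha : 0 < a) (hab : a ≤ b) (hb : b ≤ r) :
    (discLaw r).real (coneSector v a b) = coneFraction v * (b ^ 2 - a ^ 2) / r ^ 2 := by
  have hset : coneSector v a b =
      (cone v ∩ Metric.closedBall 0 b) \ (cone v ∩ Metric.closedBall 0 a) := by
    ext y
    simp only [coneSector, Set.mem_ofPred_eq, Set.mem_sdiff, Set.mem_inter_iff,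
      mem_closedBall_zero_iff, not_and, not_le]
    tauto
  have hsub : coneSector v a b ⊆ Metric.closedBall 0 r := fun y hy =>
    mem_closedBall_zero_iff.2 (hy.2.2.trans hb)
  have hr : 0 < r := by linarith
  have hfin : volume (cone v ∩ Metric.closedBall 0 b) ≠ ⊤ :=
    measure_ne_top_of_subset Set.inter_subset_right measure_closedBall_lt_top.ne
  have hmono : cone v ∩ Metric.closedBall 0 a ⊆ cone v ∩ Metric.closedBall 0 b :=
    Set.inter_subset_inter_right _ (Metric.closedBall_subset_closedBall hab)
  have hmeas : MeasurableSet (cone v ∩ Metric.closedBall 0 a) :=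
    (measurableSet_cone v).inter Metric.isClosed_closedBall.measurableSet
  rw [discLaw_real_of_subset hsub, hset, measureReal_sdiff hmono hmeas hfin, volume_real_cone_inter_closedBall v ha,
    volume_real_cone_inter_closedBall v (by linarith), volume_real_closedBall _ hr.le,
    coneFraction]
  have := volume_real_unitBall_pos
  field_simp

theorem le_discLaw_real_coneSector (v : Plane) {r a b : ℝ} (ha : 0 < a) (hab : a ≤ b) (hb : b ≤ r)
    (hrb : r / 2 ≤ b) :
    coneFraction v * ((b - a) / (2 * r)) ≤ (discLaw r).real (coneSector v a b) := by
  have hr : 0 < r := by linarith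
  rw [discLaw_real_coneSector v ha hab hb, mul_div_assoc]
  refine mul_le_mul_of_nonneg_left ?_ (by unfold coneFraction; positivity)
  rw [div_le_div_iff₀ (by positivity) (by positivity)]
  have : (b - a) * r ≤ (b - a) * (2 * (b + a)) :=
    mul_le_mul_of_nonneg_left (by linarith) (by linarith)
  nlinarith

/-! ### Empty outer sectors and their probabilities -/

theorem norm_triangleDirection (j : Fin 3) : ‖triangleDirection j‖ = 1 := by
  rw [← pow_left_inj₀ (norm_nonneg _) zero_le_one two_ne_zero]
  fin_cases j <;>
    simp [triangleDirection, EuclideanSpace.norm_sq_eq, Fin.sum_univ_two] <;> norm_num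

/-- For every disc that contains the sample, one of three outer sectors contains no sample
point. -/
theorem exists_norm_le_of_mem_centers {r : ℝ} {n : ℕ} {x : Fin n → Plane} {p : Plane}
    (hp : p ∈ centers r x) :
    ∃ j, ∀ l, x l ∈ cone (triangleDirection j) → ‖x l‖ ≤ r - ‖p‖ / 8 := by
  obtain ⟨j, hj⟩ := lt_dist_of_mem_cone (r := r) p
  refine ⟨j, fun l hl => ?_⟩
  by_contra! h
  exact absurd (hp l) (not_le.2 (hj _ hl h))

/-- The triangle inequality turns a deep vertex into a remote centre, and so into an empty sector.
-/
theorem IsVertexIndex.exists_mem_centers {r : ℝ} {n : ℕ} {x : Fin n → Plane} {i : Fin n}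
    (h : IsVertexIndex r x i) : ∃ p ∈ centers r x, r - ‖x i‖ ≤ ‖p‖ := by
  obtain ⟨p, q, -, hp, -, hip, -⟩ := h
  refine ⟨p, hp, ?_⟩
  have := norm_sub_le (x i) p
  rw [← dist_eq_norm, hip] at this
  linarith

/-- The outer sectors of thickness `q r / (8 n)`. -/
noncomputable def outerSector (r : ℝ) (n q : ℕ) (j : Fin 3) : Set Plane :=
  coneSector (triangleDirection j) (r - q * (r / n) / 8) r

theorem exists_discLaw_real_compl_outerSector_le :
    ∃ β : ℝ, 0 < β ∧ ∀ (r : ℝ) (n q : ℕ) (j : Fin 3), 0 < r → 0 < n → q ≤ n →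
      (discLaw r).real (outerSector r n q j)ᶜ ≤ Real.exp (-(β * (q / n))) := by
  obtain ⟨j₀, -, hj₀⟩ := Finset.exists_min_image (Finset.univ : Finset (Fin 3))
    (fun j => coneFraction (triangleDirection j)) ⟨0, Finset.mem_univ _⟩
  -- 16 = 8 · 2: the sector has thickness q r/(8n), and `le_discLaw_real_coneSector` loses a factor
  -- 2. Then 1 - s ≤ exp(-s).
  refine ⟨coneFraction (triangleDirection j₀) / 16,
    div_pos (coneFraction_pos (norm_triangleDirection j₀)) (by norm_num),
    fun r n q j hr hn hq => ?_⟩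
  have := isProbabilityMeasure_discLaw hr
  have hn' : (0 : ℝ) < n := Nat.cast_pos.2 hn
  have hqn : (q : ℝ) / n ≤ 1 := (div_le_one hn').2 (Nat.cast_le.2 hq)
  have hqr : (q : ℝ) * (r / n) = q / n * r := by ring
  have hqn0 : (0 : ℝ) ≤ q / n := by positivity
  rw [outerSector, probReal_compl_eq_one_sub (measurableSet_coneSector _ _ _)]
  have h1 := le_discLaw_real_coneSector (triangleDirection j) (r := r)
    (a := r - q * (r / n) / 8) (b := r) (by rw [hqr]; nlinarith) (by rw [hqr]; nlinarith) le_rfl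
    (by linarith)
  have h2 : (r - (r - q * (r / n) / 8)) / (2 * r) = q / n / 16 := by field_simp; ring
  rw [h2] at h1
  have h3 : coneFraction (triangleDirection j₀) * ((q : ℝ) / n / 16) ≤
      coneFraction (triangleDirection j) * (q / n / 16) :=
    mul_le_mul_of_nonneg_right (hj₀ j (Finset.mem_univ _)) (by positivity)
  have h4 := Real.add_one_le_exp (-(coneFraction (triangleDirection j₀) / 16 * ((q : ℝ) / n)))
  linarith

theorem exists_sum_sq_mul_exp_le {γ : ℝ} (hγ : 0 < γ) :
    ∃ M : ℝ, 0 < M ∧ ∀ n : ℕ, ∑ q ∈ Finset.range n, ((q : ℝ) + 1) ^ 2 * Real.exp (-(γ * q)) ≤ M := by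
  have h := ((summable_nat_add_iff 1).2 (Real.summable_pow_mul_exp_neg_nat_mul 2 hγ)).mul_left
    (Real.exp γ)
  have h' : Summable fun q : ℕ => ((q : ℝ) + 1) ^ 2 * Real.exp (-(γ * q)) := by
    refine h.congr fun q => ?_
    rw [mul_left_comm, ← Real.exp_add]
    push_cast
    ring_nf
  have hnn : ∀ q : ℕ, 0 ≤ ((q : ℝ) + 1) ^ 2 * Real.exp (-(γ * q)) := fun q => by positivity
  refine ⟨∑' q : ℕ, ((q : ℝ) + 1) ^ 2 * Real.exp (-(γ * q)) + 1,
    add_pos_of_nonneg_of_pos (tsum_nonneg hnn) one_pos, fun n => ?_⟩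
  linarith [h'.sum_le_tsum (Finset.range n) fun q _ => hnn q]

/-! ### Upper bound for the variance of the area -/

theorem integral_le_sum_of_ae_le_sum_indicator {Ω ι : Type*} [MeasurableSpace Ω] {ν : Measure Ω}
    [IsFiniteMeasure ν] {X : Ω → ℝ} (hX : Integrable X ν) (S : Finset ι) (w : ι → ℝ)
    {B : ι → Set Ω} (hB : ∀ a ∈ S, MeasurableSet (B a))
    (h : ∀ᵐ x ∂ν, X x ≤ ∑ a ∈ S, (B a).indicator (fun _ => w a) x) :
    ∫ x, X x ∂ν ≤ ∑ a ∈ S, ν.real (B a) * w a := by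
  have hint : ∀ a ∈ S, Integrable ((B a).indicator fun _ => w a) ν := fun a ha =>
    (integrable_const _).indicator (hB a ha)
  refine (integral_mono_ae hX (integrable_finsetSum S hint) h).trans_eq ?_
  rw [integral_finsetSum S hint]
  refine Finset.sum_congr rfl fun a ha => ?_
  rw [integral_indicator_const _ (hB a ha), smul_eq_mul]

theorem le_sum_indicator {Ω ι : Type*} {S : Finset ι} {w : ι → ℝ} (hw : ∀ a ∈ S, 0 ≤ w a)
    {B : ι → Set Ω} {a : ι} (ha : a ∈ S) {x : Ω} (hx : x ∈ B a) :
    w a ≤ ∑ b ∈ S, (B b).indicator (fun _ => w b) x := by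
  have h := Finset.single_le_sum (f := fun b => (B b).indicator (fun _ => w b) x)
    (fun b hb => Set.indicator_nonneg (fun _ _ => hw b hb) x) ha
  simpa [Set.indicator_of_mem hx] using h

theorem polygonArea_nonneg (r : ℝ) {n : ℕ} (x : Fin n → Plane) : 0 ≤ polygonArea r x :=
  ENNReal.toReal_nonneg

/-- The samples without points in an outer sector. -/
def sectorFree (r : ℝ) (n : ℕ) (a : Fin 3 × ℕ) : Set (Fin n → Plane) :=
  Set.univ.pi fun _ => (outerSector r n a.2 a.1)ᶜ

theorem measurableSet_sectorFree (r : ℝ) (n : ℕ) (a : Fin 3 × ℕ) :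
    MeasurableSet (sectorFree r n a) :=
  MeasurableSet.univ_pi fun _ => (measurableSet_coneSector _ _ _).compl

/-- The concentric disc of radius (1 - u)r lies in every containing disc, hence in the hull, and 1 -
(1 - u)² ≤ 2u. -/
theorem volume_discPolygon_deficiency_le {r : ℝ} (hr : 0 < r) {n : ℕ} {x : Fin n → Plane}
    (hx : ∀ i, ‖x i‖ ≤ r) {u : ℝ} (hu : u ≤ 1)
    (hc : ∀ p ∈ centers r x, ‖p‖ ≤ u * r) :
    volume.real (Metric.closedBall (0 : Plane) r) - polygonArea r x ≤
      volume.real (Metric.closedBall (0 : Plane) r) * (2 * u) := by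
  have h0 : (0 : Plane) ∈ centers r x := fun i => by simpa using hx i
  have hsub : discPolygon r x ⊆ Metric.closedBall 0 r := fun y hy => mem_discPolygon.1 hy 0 h0
  have hsup : Metric.closedBall 0 (r - u * r) ⊆ discPolygon r x := fun y hy =>
    mem_discPolygon.2 fun p hp => by
      have := norm_sub_le y p
      rw [dist_eq_norm]
      linarith [hc p hp, mem_closedBall_zero_iff.1 hy]
  have h1 : volume.real (Metric.closedBall (0 : Plane) (r - u * r)) ≤ polygonArea r x :=
    measureReal_mono hsup (measure_ne_top_of_subset hsub measure_closedBall_lt_top.ne)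
  rw [volume_real_closedBall _ (by nlinarith)] at h1
  rw [volume_real_closedBall _ hr.le]
  have h2 := volume_real_unitBall_pos
  have h3 : 0 ≤ r ^ 2 * u ^ 2 * volume.real (Metric.closedBall (0 : Plane) 1) := by positivity
  nlinarith

/-- One summand suffices: take the largest Q ≤ n for which an outer sector is empty of sample
points. If Q < n, maximality bounds all centres by (Q + 1) r/n. -/
theorem sq_deficiency_le_sum_indicator {r : ℝ} (hr : 0 < r) {n : ℕ} (hn : 0 < n)
    {x : Fin n → Plane} (hx : ∀ i, ‖x i‖ ≤ r) :
    (volume.real (Metric.closedBall (0 : Plane) r) - polygonArea r x) ^ 2 ≤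
      ∑ a ∈ (Finset.univ : Finset (Fin 3)) ×ˢ Finset.range (n + 1),
        (sectorFree r n a).indicator (fun _ =>
          (volume.real (Metric.closedBall (0 : Plane) r) * (2 * (((a.2 : ℝ) + 1) / n))) ^ 2) x := by
  classical
  have hn' : (0 : ℝ) < n := Nat.cast_pos.2 hn
  set W := volume.real (Metric.closedBall (0 : Plane) r) with hW
  have hW0 : 0 ≤ W := measureReal_nonneg
  have h0 : (0 : Plane) ∈ centers r x := fun i => by simpa using hx i
  have hY0 : 0 ≤ W - polygonArea r x := sub_nonneg.2
    (measureReal_mono (fun y hy => mem_discPolygon.1 hy 0 h0) measure_closedBall_lt_top.ne)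
  let P : ℕ → Prop := fun q => ∃ j, x ∈ sectorFree r n (j, q)
  -- For q = 0 the sector itself is the empty set.
  have hP0 : P 0 := ⟨0, fun l _ hl => by
    have h1 := hl.2.1
    have h2 := hl.2.2
    simp at h1
    linarith⟩
  set Q := Nat.findGreatest P n with hQ
  have hQn : Q ≤ n := Nat.findGreatest_le n
  obtain ⟨j, hj⟩ : P Q := Nat.findGreatest_spec (Nat.zero_le n) hP0
  refine le_trans (pow_le_pow_left₀ hY0 ?_ 2) (le_sum_indicator (a := (j, Q))
    (w := fun a : Fin 3 × ℕ => (W * (2 * (((a.2 : ℝ) + 1) / n))) ^ 2)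
    (fun a _ => sq_nonneg _) (by simp; omega) hj)
  rcases hQn.eq_or_lt with h | h
  -- For Q = n the weight already exceeds the whole area of K.
  · have h1 : (1 : ℝ) ≤ 2 * (((Q : ℝ) + 1) / n) := by
      rw [h, ← mul_div_assoc, le_div_iff₀ hn']
      linarith
    have h2 := polygonArea_nonneg r x
    nlinarith
  · have hQ1 : ((Q : ℝ) + 1) / n ≤ 1 := (div_le_one hn').2 (by exact_mod_cast h)
    refine volume_discPolygon_deficiency_le hr hx hQ1 fun p hp => ?_
    by_contra! hlt
    obtain ⟨j', hj'⟩ := exists_norm_le_of_mem_centers hp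
    refine Nat.findGreatest_is_greatest (Nat.lt_succ_self Q) h ⟨j', fun l _ hl => ?_⟩
    have h1 := hj' l hl.1
    have h2 := hl.2.1
    have h3 : ((Q : ℝ) + 1) / n * r = (Q + 1) * (r / n) := by ring
    push_cast at h2
    linarith

theorem memLp_polygonArea {r : ℝ} (hr : 0 < r) {n : ℕ} (hn : 0 < n) :
    MemLp (polygonArea r) 2 (uniformSample (Metric.closedBall (0 : Plane) r) n) := by
  have := isProbabilityMeasure_uniformSample hr n
  refine MemLp.of_bound (measurable_polygonArea r hn).aestronglyMeasurable
    (volume.real (Metric.closedBall (0 : Plane) r)) ?_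
  filter_upwards [ae_norm_le_uniformSample hr n] with x hx
  have h0 : (0 : Plane) ∈ centers r x := fun i => by simpa using hx i
  rw [Real.norm_of_nonneg (polygonArea_nonneg r x)]
  exact measureReal_mono (fun y hy => mem_discPolygon.1 hy 0 h0) measure_closedBall_lt_top.ne

theorem exists_variance_polygonArea_le {r : ℝ} (hr : 0 < r) :
    ∃ C : ℝ, 0 < C ∧ ∀ n : ℕ, 1 ≤ n →
      variance (polygonArea r) (uniformSample (Metric.closedBall (0 : Plane) r) n)
        ≤ C * ((n : ℝ) ^ 2)⁻¹ := by
  obtain ⟨β, hβ, hsec⟩ := exists_discLaw_real_compl_outerSector_le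
  obtain ⟨M, hM, hsum⟩ := exists_sum_sq_mul_exp_le hβ
  set W := volume.real (Metric.closedBall (0 : Plane) r) with hW
  have hW0 : 0 < W := ENNReal.toReal_pos (Metric.measure_closedBall_pos _ _ hr).ne'
    measure_closedBall_lt_top.ne
  -- Three sectors, times the 4 from the square of 2(q + 1)/n.
  refine ⟨12 * W ^ 2 * M, by positivity, fun n hn => ?_⟩
  have := isProbabilityMeasure_uniformSample hr n
  have hn' : (0 : ℝ) < n := Nat.cast_pos.2 hn
  have hL := memLp_polygonArea hr hn
  -- The second moment of the deficit W - A is already of order n⁻², so no centring is needed.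
  rw [← variance_const_sub hL.1 W]
  have hL' : MemLp (fun x => W - polygonArea r x) 2
    (uniformSample (Metric.closedBall (0 : Plane) r) n) := (memLp_const W).sub hL
  refine (variance_le_expectation_sq hL'.1).trans ?_
  refine (integral_le_sum_of_ae_le_sum_indicator hL'.integrable_sq
    ((Finset.univ : Finset (Fin 3)) ×ˢ Finset.range (n + 1))
    (fun a => (W * (2 * (((a.2 : ℝ) + 1) / n))) ^ 2)
    (fun a _ => measurableSet_sectorFree r n a) (by
      filter_upwards [ae_norm_le_uniformSample hr n] with x hx
      exact sq_deficiency_le_sum_indicator hr hn hx)).trans ?_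
  rw [Finset.sum_product]
  have hj : ∀ j : Fin 3, ∑ q ∈ Finset.range (n + 1),
      (uniformSample (Metric.closedBall (0 : Plane) r) n).real (sectorFree r n (j, q)) *
        (W * (2 * (((q : ℝ) + 1) / n))) ^ 2 ≤ 4 * W ^ 2 * ((n : ℝ) ^ 2)⁻¹ * M := fun j => by
    refine le_trans ?_ (mul_le_mul_of_nonneg_left (hsum (n + 1)) (by positivity))
    rw [Finset.mul_sum]
    refine Finset.sum_le_sum fun q hq => ?_
    have h1 : (uniformSample (Metric.closedBall (0 : Plane) r) n).real (sectorFree r n (j, q)) ≤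
        Real.exp (-(β * q)) := by
      rw [sectorFree, uniformSample_real_pi hr, Finset.prod_const, Finset.card_univ,
        Fintype.card_fin]
      refine (pow_le_pow_left₀ measureReal_nonneg
        (hsec r n q j hr hn (Nat.lt_succ_iff.1 (Finset.mem_range.1 hq))) n).trans_eq ?_
      rw [← Real.exp_nat_mul]
      congr 1
      field_simp
    refine (mul_le_mul_of_nonneg_right h1 (sq_nonneg _)).trans_eq ?_
    field_simp
    ring
  refine (Finset.sum_le_sum fun j _ => hj j).trans_eq ?_
  rw [Finset.sum_const, Finset.card_univ, Fintype.card_fin, nsmul_eq_mul]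
  push_cast
  ring

/-! ### Upper bound for the variance of the vertex number -/

theorem memLp_vertexNumber {r : ℝ} (hr : 0 < r) {n : ℕ} (hn : 0 < n) :
    MemLp (vertexNumber r) 2 (uniformSample (Metric.closedBall (0 : Plane) r) n) := by
  have := isProbabilityMeasure_uniformSample hr n
  refine MemLp.of_bound (measurable_vertexNumber hr hn).aestronglyMeasurable n
    (Filter.Eventually.of_forall fun x => ?_)
  rw [Real.norm_of_nonneg (vertexNumber_nonneg r x)]
  exact vertexNumber_le hr hn x

/-- The samples whose points number `i` and `k` are close to the boundary, while the others avoid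
an outer sector. -/
def pairSectorFree (r : ℝ) (n : ℕ) (i k : Fin n) (j : Fin 3) (q : ℕ) : Set (Fin n → Plane) :=
  Set.univ.pi fun l => if l = i ∨ l = k then (Metric.closedBall 0 (r - (q + 1) * (r / n)))ᶜ
    else (outerSector r n q j)ᶜ

theorem measurableSet_pairSectorFree (r : ℝ) (n : ℕ) (i k : Fin n) (j : Fin 3) (q : ℕ) :
    MeasurableSet (pairSectorFree r n i k j q) := by
  refine MeasurableSet.univ_pi fun l => ?_
  split_ifs
  · exact Metric.isClosed_closedBall.measurableSet.compl
  · exact (measurableSet_coneSector _ _ _).compl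

/-- Let m be the larger depth of the two vertices. The deeper one yields a centre of norm at least
m, so some sector is empty to depth m/8. Rounding m down to q r/n gives q ≤ n, with both depths
below (q + 1) r/n. -/
theorem exists_mem_pairSectorFree {r : ℝ} (hr : 0 < r) {n : ℕ} (hn : 0 < n)
    {x : Fin n → Plane} (hx : ∀ i, ‖x i‖ ≤ r) {i k : Fin n} (hi : IsVertexIndex r x i)
    (hk : IsVertexIndex r x k) :
    ∃ j, ∃ q ∈ Finset.range (n + 1), x ∈ pairSectorFree r n i k j q := by
  have hn' : (0 : ℝ) < n := Nat.cast_pos.2 hn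
  have hδ : 0 < r / n := by positivity
  set m := max (r - ‖x i‖) (r - ‖x k‖) with hm
  have hm0 : 0 ≤ m := le_max_of_le_left (sub_nonneg.2 (hx i))
  have hmr : m ≤ r := max_le (by linarith [norm_nonneg (x i)]) (by linarith [norm_nonneg (x k)])
  obtain ⟨p, hp, hmp⟩ : ∃ p ∈ centers r x, m ≤ ‖p‖ := by
    rcases max_choice (r - ‖x i‖) (r - ‖x k‖) with h | h
    · rw [hm, h]; exact hi.exists_mem_centers
    · rw [hm, h]; exact hk.exists_mem_centers
  obtain ⟨j, hj⟩ := exists_norm_le_of_mem_centers hp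
  have hq1 : (⌊m / (r / n)⌋₊ : ℝ) * (r / n) ≤ m :=
    (le_div_iff₀ hδ).1 (Nat.floor_le (by positivity))
  have hq2 : m < ((⌊m / (r / n)⌋₊ : ℝ) + 1) * (r / n) :=
    (div_lt_iff₀ hδ).1 (Nat.lt_floor_add_one _)
  refine ⟨j, ⌊m / (r / n)⌋₊, ?_, fun l _ => ?_⟩
  · rw [Finset.mem_range, Nat.lt_succ_iff]
    refine Nat.floor_le_of_le ?_
    rw [div_le_iff₀ hδ, mul_div_cancel₀ _ hn'.ne']
    exact hmr
  · show x l ∈ if _ then _ else _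
    split_ifs with hl
    · rw [Set.mem_compl_iff, mem_closedBall_zero_iff, not_le]
      rcases hl with rfl | rfl
      · linarith [le_max_left (r - ‖x l‖) (r - ‖x k‖)]
      · linarith [le_max_right (r - ‖x i‖) (r - ‖x l‖)]
    · intro h
      have h1 := hj l h.1
      have h2 := h.2.1
      linarith

theorem uniformSample_real_pairSectorFree_le {r : ℝ} (hr : 0 < r) {β : ℝ} (hβ : 0 < β) {n : ℕ}
    (hn : 3 ≤ n) {i k : Fin n} (hik : i ≠ k) {j : Fin 3} {q : ℕ}
    (h : (discLaw r).real (outerSector r n q j)ᶜ ≤ Real.exp (-(β * (q / n)))) :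
    (uniformSample (Metric.closedBall (0 : Plane) r) n).real (pairSectorFree r n i k j q) ≤
      (4 * ((n : ℝ) ^ 2)⁻¹) * (((q : ℝ) + 1) ^ 2 * Real.exp (-(β / 3 * q))) := by
  have hn' : (0 : ℝ) < n := Nat.cast_pos.2 (by omega)
  have h1 : (discLaw r).real (Metric.closedBall 0 (r - (q + 1) * (r / n)))ᶜ ≤
      2 * (((q : ℝ) + 1) / n) := by
    refine (discLaw_real_compl_closedBall_le hr (by positivity)).trans_eq ?_
    field_simp
  have hc : (Finset.univ.filter fun l : Fin n => l = i ∨ l = k).card = 2 := by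
    rw [Finset.filter_or, Finset.filter_eq', Finset.filter_eq']
    simpa using Finset.card_pair hik
  have hc' : (Finset.univ.filter fun l : Fin n => ¬(l = i ∨ l = k)).card = n - 2 := by
    have := Finset.card_filter_add_card_filter_not (s := (Finset.univ : Finset (Fin n)))
      (fun l => l = i ∨ l = k)
    rw [hc, Finset.card_univ, Fintype.card_fin] at this
    omega
  -- Only n - 2 points are left to avoid the sector, and (n - 2)/n ≥ 1/3 for n ≥ 3.
  have h2 : Real.exp (-(β * (q / n))) ^ (n - 2) ≤ Real.exp (-(β / 3 * q)) := by
    rw [← Real.exp_nat_mul]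
    refine Real.exp_le_exp.2 ?_
    rw [Nat.cast_sub (by omega)]
    have h3 : (3 : ℝ) ≤ n := by exact_mod_cast hn
    have h4 : 1 / 3 ≤ ((n : ℝ) - 2) / n := by
      rw [div_le_div_iff₀ (by norm_num) hn']; linarith
    have h5 : ((n : ℝ) - ((2 : ℕ) : ℝ)) * -(β * (q / n)) = -(β * q * (((n : ℝ) - 2) / n)) := by
      push_cast; field_simp
    have h6 : β * q * (1 / 3) ≤ β * q * (((n : ℝ) - 2) / n) :=
      mul_le_mul_of_nonneg_left h4 (by positivity)
    rw [h5]
    linarith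
  rw [pairSectorFree, uniformSample_real_pi hr]
  calc _ = ∏ l : Fin n, if l = i ∨ l = k then
          (discLaw r).real (Metric.closedBall 0 (r - (q + 1) * (r / n)))ᶜ
          else (discLaw r).real (outerSector r n q j)ᶜ :=
        Finset.prod_congr rfl fun l _ => by split_ifs <;> rfl
    _ = (discLaw r).real (Metric.closedBall 0 (r - (q + 1) * (r / n)))ᶜ ^ 2 *
          (discLaw r).real (outerSector r n q j)ᶜ ^ (n - 2) := by
        rw [Finset.prod_ite, Finset.prod_const, Finset.prod_const, hc, hc']
    _ ≤ (2 * (((q : ℝ) + 1) / n)) ^ 2 * Real.exp (-(β / 3 * q)) :=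
        mul_le_mul (pow_le_pow_left₀ measureReal_nonneg h1 2)
          ((pow_le_pow_left₀ measureReal_nonneg h _).trans h2)
          (pow_nonneg measureReal_nonneg _) (by positivity)
    _ = _ := by field_simp; ring

theorem sq_vertexNumber_le_sum_indicator {r : ℝ} (hr : 0 < r) {n : ℕ} (hn : 0 < n)
    {x : Fin n → Plane} (hx : ∀ i, ‖x i‖ ≤ r) :
    vertexNumber r x ^ 2 - 1 ≤
      ∑ a ∈ (Finset.univ : Finset (Fin n)).offDiag ×ˢ
          ((Finset.univ : Finset (Fin 3)) ×ˢ Finset.range (n + 1)),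
        (pairSectorFree r n a.1.1 a.1.2 a.2.1 a.2.2).indicator (fun _ => (2 : ℝ)) x := by
  classical
  let V : Finset (Fin n) := Finset.univ.filter fun i => IsVertexIndex r x i
  have hV := vertexNumber_le_of_forall_mem hr hn (x := x) (T := V) fun i hi => by simpa [V] using hi
  -- v² - 1 ≤ 2v(v - 1), because (v - 1)² ≥ 0; only pairs of distinct vertices need counting.
  have h1 : vertexNumber r x ^ 2 - 1 ≤ V.offDiag.card * 2 := by
    rw [Finset.offDiag_card, Nat.cast_sub (Nat.le_mul_self _)]
    push_cast
    have := pow_le_pow_left₀ (vertexNumber_nonneg r x) hV 2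
    nlinarith [sq_nonneg ((V.card : ℝ) - 1)]
  let F : Fin n × Fin n → ℝ := fun a => ∑ b ∈ (Finset.univ : Finset (Fin 3)) ×ˢ Finset.range (n + 1),
    (pairSectorFree r n a.1 a.2 b.1 b.2).indicator (fun _ => (2 : ℝ)) x
  have hF0 : ∀ a, 0 ≤ F a := fun a =>
    Finset.sum_nonneg fun b _ => Set.indicator_nonneg (fun _ _ => zero_le_two) x
  have hF2 : ∀ a ∈ V.offDiag, 2 ≤ F a := fun a ha => by
    obtain ⟨ha1, ha2, -⟩ := Finset.mem_offDiag.1 ha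
    obtain ⟨j, q, hq, hmem⟩ := exists_mem_pairSectorFree hr hn hx (Finset.mem_filter.1 ha1).2
      (Finset.mem_filter.1 ha2).2
    exact le_sum_indicator (w := fun _ => (2 : ℝ)) (a := (j, q))
      (B := fun b : Fin 3 × ℕ => pairSectorFree r n a.1 a.2 b.1 b.2) (fun _ _ => zero_le_two)
      (Finset.mem_product.2 ⟨Finset.mem_univ j, hq⟩) hmem
  have h2 : (V.offDiag.card : ℝ) * 2 ≤ ∑ a ∈ V.offDiag, F a := by
    rw [← nsmul_eq_mul]
    exact Finset.card_nsmul_le_sum _ _ _ hF2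
  have h3 : ∑ a ∈ V.offDiag, F a ≤ ∑ a ∈ (Finset.univ : Finset (Fin n)).offDiag, F a :=
    Finset.sum_le_sum_of_subset_of_nonneg (Finset.offDiag_mono (Finset.subset_univ V))
      fun a _ _ => hF0 a
  rw [Finset.sum_product]
  exact h1.trans (h2.trans h3)

theorem exists_variance_vertexNumber_le {r : ℝ} (hr : 0 < r) :
    ∃ C : ℝ, 0 < C ∧ ∀ n : ℕ, 1 ≤ n →
      variance (vertexNumber r) (uniformSample (Metric.closedBall (0 : Plane) r) n) ≤ C := by
  obtain ⟨β, hβ, hsec⟩ := exists_discLaw_real_compl_outerSector_le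
  obtain ⟨M, hM, hsum⟩ := exists_sum_sq_mul_exp_le (γ := β / 3) (by positivity)
  -- The 4 covers n < 3, where there are at most two vertices, and absorbs the 1 subtracted for n ≥
  -- 3. The 24 is the weight 2, times 3 sectors, times the 4 of the pair probability.
  refine ⟨4 + 24 * M, by positivity, fun n hn => ?_⟩
  have := isProbabilityMeasure_uniformSample hr n
  have hn' : (0 : ℝ) < n := Nat.cast_pos.2 hn
  have hL := memLp_vertexNumber hr hn
  refine (variance_le_expectation_sq hL.1).trans ?_
  rcases Nat.lt_or_ge n 3 with hn3 | hn3
  · have h1 : ∫ x, vertexNumber r x ^ 2 ∂uniformSample (Metric.closedBall (0 : Plane) r) n ≤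
        ∫ _, (4 : ℝ) ∂uniformSample (Metric.closedBall (0 : Plane) r) n := by
      refine integral_mono hL.integrable_sq (integrable_const _) fun x => ?_
      have h2 : (n : ℝ) ≤ 2 := by exact_mod_cast Nat.lt_succ_iff.1 hn3
      have h3 := (vertexNumber_le hr hn x).trans h2
      have h4 := vertexNumber_nonneg r x
      nlinarith
    rw [integral_const, probReal_univ, one_smul] at h1
    refine le_trans h1 ?_
    linarith
  · have h1 := integral_le_sum_of_ae_le_sum_indicator (hL.integrable_sq.sub (integrable_const 1))
      ((Finset.univ : Finset (Fin n)).offDiag ×ˢ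
          ((Finset.univ : Finset (Fin 3)) ×ˢ Finset.range (n + 1))) (fun _ => (2 : ℝ))
      (B := fun a => pairSectorFree r n a.1.1 a.1.2 a.2.1 a.2.2)
      (fun a _ => measurableSet_pairSectorFree r n _ _ _ _) (by
        filter_upwards [ae_norm_le_uniformSample hr n] with x hx
        exact sq_vertexNumber_le_sum_indicator hr hn hx)
    rw [integral_sub' hL.integrable_sq (integrable_const 1), integral_const, probReal_univ,
      one_smul, Finset.sum_product] at h1
    have h2 : ∀ a ∈ (Finset.univ : Finset (Fin n)).offDiag,
        ∑ b ∈ (Finset.univ : Finset (Fin 3)) ×ˢ Finset.range (n + 1),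
          (uniformSample (Metric.closedBall (0 : Plane) r) n).real
            (pairSectorFree r n a.1 a.2 b.1 b.2) * 2 ≤ 24 * ((n : ℝ) ^ 2)⁻¹ * M := fun a ha => by
      rw [Finset.sum_product]
      have h3 : ∀ j : Fin 3, ∑ q ∈ Finset.range (n + 1),
          (uniformSample (Metric.closedBall (0 : Plane) r) n).real
            (pairSectorFree r n a.1 a.2 j q) * 2 ≤ 8 * ((n : ℝ) ^ 2)⁻¹ * M := fun j => by
        refine le_trans ?_ (mul_le_mul_of_nonneg_left (hsum (n + 1)) (by positivity))
        rw [Finset.mul_sum]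
        refine Finset.sum_le_sum fun q hq => ?_
        have := uniformSample_real_pairSectorFree_le hr hβ hn3 (Finset.mem_offDiag.1 ha).2.2
          (hsec r n q j hr hn (Nat.lt_succ_iff.1 (Finset.mem_range.1 hq)))
        linarith
      refine (Finset.sum_le_sum fun j _ => h3 j).trans_eq ?_
      rw [Finset.sum_const, Finset.card_univ, Fintype.card_fin, nsmul_eq_mul]
      push_cast
      ring
    have h4 := h1.trans (Finset.sum_le_sum h2)
    have h5 : ((Finset.univ : Finset (Fin n)).offDiag.card : ℝ) ≤ (n : ℝ) ^ 2 := by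
      rw [Finset.offDiag_card, Finset.card_univ, Fintype.card_fin, sq]
      exact_mod_cast Nat.sub_le _ _
    rw [Finset.sum_const, nsmul_eq_mul] at h4
    have h6 := mul_le_mul_of_nonneg_right h5 (by positivity : 0 ≤ 24 * ((n : ℝ) ^ 2)⁻¹ * M)
    have h7 : (n : ℝ) ^ 2 * (24 * ((n : ℝ) ^ 2)⁻¹ * M) = 24 * M := by field_simp
    have h8 : ∫ x, (vertexNumber r ^ 2 : (Fin n → Plane) → ℝ) x
        ∂uniformSample (Metric.closedBall (0 : Plane) r) n =
        ∫ x, vertexNumber r x ^ 2 ∂uniformSample (Metric.closedBall (0 : Plane) r) n := rfl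
    linarith

/-! ### Lower bound for the variance: configurations of non-vanishing probability -/

/-- Wherever the mean lies, one of the two events is at distance at least 1/2 from it; Chebyshev's
inequality then applies. -/
theorem le_variance_of_le_measureReal {Ω : Type*} [MeasurableSpace Ω] {ν : Measure Ω}
    [IsProbabilityMeasure ν] {X : Ω → ℝ} (hX : MemLp X 2 ν) {m c : ℝ}
    (h1 : c ≤ ν.real {x | X x ≤ m}) (h2 : c ≤ ν.real {x | m + 1 ≤ X x}) :
    c / 4 ≤ variance X ν := by
  have h3 : c ≤ ν.real {x | 1 / 2 ≤ |X x - ν[X]|} := by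
    rcases le_total (m + 1 / 2) ν[X] with h | h
    · refine h1.trans (measureReal_mono fun x (hx : X x ≤ m) => ?_)
      change 1 / 2 ≤ |X x - ∫ y, X y ∂ν|
      exact le_abs.2 (Or.inr (by linarith))
    · refine h2.trans (measureReal_mono fun x (hx : m + 1 ≤ X x) => ?_)
      change 1 / 2 ≤ |X x - ∫ y, X y ∂ν|
      exact le_abs.2 (Or.inl (by linarith))
  have h4 := ENNReal.toReal_mono ENNReal.ofReal_ne_top
    (meas_ge_le_variance_div_sq hX (c := 1 / 2) (by norm_num))
  rw [ENNReal.toReal_ofReal (div_nonneg (variance_nonneg _ _) (by norm_num))] at h4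
  have h5 := h3.trans h4
  rw [le_div_iff₀ (by norm_num)] at h5
  linarith

/-- Each of the k factors of the falling factorial is at least n + 1 - k ≥ n/k. This counts the
labellings of k special points among n. -/
theorem pow_le_descFactorial_mul_pow {k n : ℕ} (h : k ≤ n) :
    n ^ k ≤ n.descFactorial k * k ^ k := by
  rcases Nat.eq_zero_or_pos k with rfl | hk
  · simp
  have h1 : n ≤ (n + 1 - k) * k := by
    obtain ⟨d, rfl⟩ := Nat.exists_eq_add_of_le h
    rw [show k + d + 1 - k = d + 1 by omega]
    nlinarith
  calc n ^ k ≤ ((n + 1 - k) * k) ^ k := Nat.pow_le_pow_left h1 k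
    _ = (n + 1 - k) ^ k * k ^ k := mul_pow _ _ _
    _ ≤ _ := Nat.mul_le_mul_right _ (Nat.pow_sub_le_descFactorial n k)

/-- The samples with exactly one point in each of the sets `S j` and all other points in `I`, where
`σ j` is the number of the point in `S j`. -/
def labelledConfig {k n : ℕ} (S : Fin k → Set Plane) (I : Set Plane) (σ : Fin k ↪ Fin n) :
    Set (Fin n → Plane) :=
  Set.univ.pi (Function.extend σ S fun _ => I)

theorem mem_labelledConfig {k n : ℕ} {S : Fin k → Set Plane} {I : Set Plane} {σ : Fin k ↪ Fin n}
    {x : Fin n → Plane} : x ∈ labelledConfig S I σ ↔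
      (∀ j, x (σ j) ∈ S j) ∧ ∀ i, (¬∃ j, σ j = i) → x i ∈ I := by
  refine ⟨fun h => ⟨fun j => ?_, fun i hi => ?_⟩, fun h i _ => ?_⟩
  · have := h (σ j) (Set.mem_univ _)
    rwa [σ.injective.extend_apply] at this
  · have := h i (Set.mem_univ _)
    rwa [Function.extend_apply' _ _ _ hi] at this
  · by_cases hi : ∃ j, σ j = i
    · obtain ⟨j, rfl⟩ := hi
      rw [σ.injective.extend_apply]
      exact h.1 j
    · rw [Function.extend_apply' _ _ _ hi]
      exact h.2 i hi

theorem measurableSet_labelledConfig {k n : ℕ} {S : Fin k → Set Plane} {I : Set Plane}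
    (hS : ∀ j, MeasurableSet (S j)) (hI : MeasurableSet I) (σ : Fin k ↪ Fin n) :
    MeasurableSet (labelledConfig S I σ) := by
  refine MeasurableSet.univ_pi fun i => ?_
  by_cases hi : ∃ j, σ j = i
  · obtain ⟨j, rfl⟩ := hi
    rw [σ.injective.extend_apply]
    exact hS j
  · rw [Function.extend_apply' _ _ _ hi]
    exact hI

theorem disjoint_labelledConfig {k n : ℕ} {S : Fin k → Set Plane} {I : Set Plane}
    (hSS : Pairwise fun i j => Disjoint (S i) (S j)) (hSI : ∀ j, Disjoint (S j) I)
    {σ τ : Fin k ↪ Fin n} (h : σ ≠ τ) :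
    Disjoint (labelledConfig S I σ) (labelledConfig S I τ) := by
  refine Set.disjoint_left.2 fun x hx hx' => h (DFunLike.ext _ _ fun j => ?_)
  rw [mem_labelledConfig] at hx hx'
  by_cases hj : ∃ j', τ j' = σ j
  · obtain ⟨j', hj'⟩ := hj
    have : j = j' := by
      by_contra hne
      exact Set.disjoint_left.1 (hSS hne) (hx.1 j) (hj' ▸ hx'.1 j')
    rw [← hj', this]
  · exact absurd (hx'.2 _ hj) (Set.disjoint_left.1 (hSI j) (hx.1 j))

theorem le_uniformSample_real_labelledConfig {r : ℝ} (hr : 0 < r) {k n : ℕ} (hn : 0 < n)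
    {S : Fin k → Set Plane} {I : Set Plane} {a : Fin k → ℝ} (ha0 : ∀ j, 0 ≤ a j)
    (ha : ∀ j, a j / n ≤ (discLaw r).real (S j)) (hI : 1 - 1 / (2 * n) ≤ (discLaw r).real I)
    (σ : Fin k ↪ Fin n) :
    (∏ j, a j) / n ^ k / 2 ≤
      (uniformSample (Metric.closedBall (0 : Plane) r) n).real (labelledConfig S I σ) := by
  classical
  have := isProbabilityMeasure_discLaw hr
  have hn' : (1 : ℝ) ≤ n := by exact_mod_cast hn
  have hb : 1 / (2 * (n : ℝ)) ≤ 1 := by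
    rw [div_le_one (by linarith)]; linarith
  rw [labelledConfig, uniformSample_real_pi hr,
    ← Finset.prod_mul_prod_compl (Finset.univ.map σ), Finset.prod_map, div_eq_mul_inv _ (2 : ℝ)]
  refine mul_le_mul ?_ ?_ (by norm_num) (Finset.prod_nonneg fun _ _ => measureReal_nonneg)
  · calc (∏ j, a j) / (n : ℝ) ^ k = ∏ j, a j / n := by
          rw [Finset.prod_div_distrib, Finset.prod_const, Finset.card_univ, Fintype.card_fin]
      _ ≤ _ := Finset.prod_le_prod (fun j _ => div_nonneg (ha0 j) (by linarith)) fun j _ => by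
          rw [σ.injective.extend_apply]
          exact ha j
  · have h1 : ∏ i ∈ (Finset.univ.map σ)ᶜ,
        (discLaw r).real (Function.extend σ S (fun _ => I) i) =
        (discLaw r).real I ^ ((Finset.univ.map σ)ᶜ).card := by
      rw [← Finset.prod_const]
      refine Finset.prod_congr rfl fun i hi => ?_
      rw [Function.extend_apply' _ _ _ (by simpa using hi)]
    rw [h1]
    -- Bernoulli's inequality: (1 - 1/(2n))ⁿ ≥ 1/2.
    calc (2 : ℝ)⁻¹ = 1 + n * (-(1 / (2 * (n : ℝ)))) := by field_simp; norm_num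
      _ ≤ (1 + -(1 / (2 * (n : ℝ)))) ^ n := one_add_mul_le_pow (by linarith) n
      _ ≤ (discLaw r).real I ^ n := pow_le_pow_left₀ (by linarith) (by linarith) n
      _ ≤ _ := pow_le_pow_of_le_one measureReal_nonneg measureReal_le_one
        ((Finset.card_le_univ _).trans_eq (Fintype.card_fin n))

/-- A single labelling has probability of order n⁻ᵏ; there are at least nᵏ/kᵏ labellings, and their
events are disjoint. -/
theorem le_uniformSample_real_iUnion_labelledConfig {r : ℝ} (hr : 0 < r) {k n : ℕ} (hn : 0 < n)
    (hk : 0 < k) (hkn : k ≤ n)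
    {S : Fin k → Set Plane} {I : Set Plane} {a : Fin k → ℝ} (ha0 : ∀ j, 0 ≤ a j)
    (ha : ∀ j, a j / n ≤ (discLaw r).real (S j)) (hI : 1 - 1 / (2 * n) ≤ (discLaw r).real I)
    (hSS : Pairwise fun i j => Disjoint (S i) (S j)) (hSI : ∀ j, Disjoint (S j) I)
    (hSm : ∀ j, MeasurableSet (S j)) (hIm : MeasurableSet I) :
    (∏ j, a j) / k ^ k / 2 ≤ (uniformSample (Metric.closedBall (0 : Plane) r) n).real
      (⋃ σ : Fin k ↪ Fin n, labelledConfig S I σ) := by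
  have := isProbabilityMeasure_uniformSample hr n
  have hn' : (0 : ℝ) < n := Nat.cast_pos.2 hn
  have hk' : (0 : ℝ) < k := Nat.cast_pos.2 hk
  rw [measureReal_iUnion_fintype (fun σ τ h => disjoint_labelledConfig hSS hSI h)
    fun σ => measurableSet_labelledConfig hSm hIm σ]
  refine le_trans ?_ (Finset.card_nsmul_le_sum _ _ _ fun σ _ =>
    le_uniformSample_real_labelledConfig hr hn ha0 ha hI σ)
  rw [Finset.card_univ, Fintype.card_embedding_eq, Fintype.card_fin, Fintype.card_fin,
    nsmul_eq_mul]
  have h1 : (n : ℝ) ^ k ≤ n.descFactorial k * k ^ k := by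
    exact_mod_cast pow_le_descFactorial_mul_pow hkn
  have h2 : 0 ≤ ∏ j, a j := Finset.prod_nonneg fun j _ => ha0 j
  have h3 : 1 / (k : ℝ) ^ k ≤ n.descFactorial k / (n : ℝ) ^ k := by
    rw [div_le_div_iff₀ (by positivity) (by positivity)]
    linarith
  calc (∏ j, a j) / (k : ℝ) ^ k / 2 = (∏ j, a j) / 2 * (1 / (k : ℝ) ^ k) := by ring
    _ ≤ (∏ j, a j) / 2 * (n.descFactorial k / (n : ℝ) ^ k) :=
      mul_le_mul_of_nonneg_left h3 (by positivity)
    _ = _ := by ring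

theorem inner_le_of_mem_cone_of_mem_cone {v w y z : Plane} (hv : ‖v‖ = 1)
    (hvw : inner ℝ v w ≤ 0) (hy : y ∈ cone v) (hz : z ∈ cone w) :
    inner ℝ y z ≤ ‖y‖ * ‖z‖ / 4 := by
  have h1 := inner_le_of_mem_cone hy z
  have h2 := inner_le_of_mem_cone hz v
  rw [hv, mul_one, real_inner_comm, real_inner_comm v w] at h2
  have h3 := mul_nonpos_of_nonneg_of_nonpos (norm_nonneg z) hvw
  have h4 := mul_le_mul_of_nonneg_left (h2.trans (add_le_of_nonpos_right h3)) (norm_nonneg y)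
  linarith

/-- The samples with one point in each cone around `v j` very close to the boundary, and no other
point close to it. -/
def cornerConfig (r : ℝ) {k : ℕ} (v : Fin k → Plane) (n : ℕ) : Set (Fin n → Plane) :=
  ⋃ σ : Fin k ↪ Fin n, labelledConfig
    (fun j => coneSector (v j) (r - r / (32 * n)) (r - r / (32 * n) / 2))
    (Metric.closedBall 0 (r - 8 * (r / (32 * n)))) σ

theorem disjoint_coneSector {v w : Plane} (hv : ‖v‖ = 1) (hvw : inner ℝ v w ≤ 0) {a b : ℝ}
    (ha : 0 ≤ a) : Disjoint (coneSector v a b) (coneSector w a b) := by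
  refine Set.disjoint_left.2 fun y hy hy' => ?_
  have h1 := inner_le_of_mem_cone_of_mem_cone hv hvw hy.1 hy'.1
  rw [real_inner_self_eq_norm_sq] at h1
  nlinarith [hy.2.1]

theorem exists_le_uniformSample_real_cornerConfig {r : ℝ} (hr : 0 < r) {k : ℕ} (hk : 0 < k)
    {v : Fin k → Plane} (hv : ∀ j, ‖v j‖ = 1) (hvv : ∀ i j, i ≠ j → inner ℝ (v i) (v j) ≤ 0) :
    ∃ c : ℝ, 0 < c ∧ ∀ n, k ≤ n →
      c ≤ (uniformSample (Metric.closedBall (0 : Plane) r) n).real (cornerConfig r v n) := by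
  have hpos : ∀ j, 0 < coneFraction (v j) / 128 := fun j =>
    div_pos (coneFraction_pos (hv j)) (by norm_num)
  have hk' : (0 : ℝ) < k := Nat.cast_pos.2 hk
  -- A sector of thickness r/(64n) has mass at least the cone fraction over 128n. The ring of width
  -- 8r/(32n) has mass at most 1/(2n), which explains the 32.
  refine ⟨(∏ j, coneFraction (v j) / 128) / k ^ k / 2,
    div_pos (div_pos (Finset.prod_pos fun j _ => hpos j) (by positivity)) two_pos,
    fun n hkn => ?_⟩
  have hn' : (1 : ℝ) ≤ n := by exact_mod_cast hk.trans_le hkn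
  have hs : 0 < r / (32 * n) := by positivity
  have hs' : r / (32 * n) ≤ r / 32 := div_le_div_of_nonneg_left hr.le (by norm_num) (by linarith)
  refine le_uniformSample_real_iUnion_labelledConfig hr (hk.trans_le hkn) hk hkn
    (fun j => (hpos j).le) (fun j => ?_) ?_ (fun i j hij => ?_) (fun j => ?_)
    (fun j => measurableSet_coneSector _ _ _) Metric.isClosed_closedBall.measurableSet
  · refine le_trans (le_of_eq ?_) (le_discLaw_real_coneSector (v j) (by linarith) (by linarith)
      (by linarith) (by linarith))
    field_simp
    ring
  · refine le_trans (le_of_eq ?_) (one_sub_le_discLaw_real_closedBall hr (by positivity))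
    field_simp
    ring
  · exact disjoint_coneSector (hv i) (hvv i j hij) (by linarith)
  · refine Set.disjoint_left.2 fun y hy hy' => ?_
    have := hy.2.1
    have := mem_closedBall_zero_iff.1 hy'
    linarith

/-- With s = r/(32n), any further vertex would have depth at least 8s, hence a centre of norm at
least 8s, hence a sector empty to depth s. But each of the three sectors holds a point of depth less
than s. -/
theorem vertexNumber_le_of_mem_cornerConfig {r : ℝ} (hr : 0 < r) {n : ℕ} (hn : 0 < n)
    {x : Fin n → Plane} (hx : x ∈ cornerConfig r triangleDirection n) : vertexNumber r x ≤ 3 := by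
  classical
  obtain ⟨σ, hσ⟩ := Set.mem_iUnion.1 hx
  obtain ⟨h1, h2⟩ := mem_labelledConfig.1 hσ
  have h3 := vertexNumber_le_of_forall_mem hr hn (x := x) (T := Finset.univ.map σ) fun i hi => by
    by_contra hne
    obtain ⟨p, hp, hip⟩ := hi.exists_mem_centers
    obtain ⟨j, hj⟩ := exists_norm_le_of_mem_centers hp
    have h4 := hj (σ j) (h1 j).1
    have h5 := (h1 j).2.1
    have h6 := mem_closedBall_zero_iff.1 (h2 i (by simpa using hne))
    linarith
  simpa using h3

/-- Shift K away from the corner by its depth t < s, so that the corner lies on the circle. Points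
of depth at least 8s stay inside. For another corner the near-orthogonality of the cones limits the
growth of the squared distance to about sr/2, while its depth of at least s/2 provides about sr. -/
theorem le_vertexNumber_of_mem_cornerConfig {r : ℝ} (hr : 0 < r) {k : ℕ} {v : Fin k → Plane}
    (hv : ∀ j, ‖v j‖ = 1) (hvv : ∀ i j, i ≠ j → inner ℝ (v i) (v j) ≤ 0) {n : ℕ} (hn : 0 < n)
    {x : Fin n → Plane} (hx : x ∈ cornerConfig r v n) : (k : ℝ) ≤ vertexNumber r x := by
  have hn' : (1 : ℝ) ≤ n := by exact_mod_cast hn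
  have hs : 0 < r / (32 * n) := by positivity
  have hs' : r / (32 * n) ≤ r / 32 := div_le_div_of_nonneg_left hr.le (by norm_num) (by linarith)
  obtain ⟨σ, hσ⟩ := Set.mem_iUnion.1 hx
  obtain ⟨h1, h2⟩ := mem_labelledConfig.1 hσ
  generalize r / (32 * n) = s at *
  refine le_vertexNumber hr hn σ (fun i j hij => ?_) fun j => ?_
  · by_contra hne
    refine Set.disjoint_left.1 (disjoint_coneSector (hv i) (hvv i j hne) (by linarith)) (h1 i) ?_
    have h3 := h1 j
    simp only at hij
    rwa [← hij] at h3
  · obtain ⟨hc, hlo, hhi⟩ := h1 j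
    have hx0 : 0 < ‖x (σ j)‖ := by linarith
    set t := r - ‖x (σ j)‖ with ht
    have htn : ‖(t / ‖x (σ j)‖) • x (σ j)‖ = t := by
      rw [norm_smul, Real.norm_of_nonneg (div_nonneg (by linarith) hx0.le),
        div_mul_cancel₀ _ hx0.ne']
    refine isVertexIndex_of_forall_lt hr (p := -((t / ‖x (σ j)‖) • x (σ j))) ?_ fun l hl => ?_
    · have h3 : x (σ j) + (t / ‖x (σ j)‖) • x (σ j) = (1 + t / ‖x (σ j)‖) • x (σ j) := by
        rw [add_smul, one_smul]
      rw [dist_eq_norm, sub_neg_eq_add, h3, norm_smul, Real.norm_of_nonneg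
        (add_nonneg zero_le_one (div_nonneg (by linarith) hx0.le)), add_mul, one_mul,
        div_mul_cancel₀ _ hx0.ne']
      linarith
    · rw [dist_eq_norm, sub_neg_eq_add]
      by_cases hlr : ∃ j', σ j' = l
      · obtain ⟨j', rfl⟩ := hlr
        obtain ⟨hc', hlo', hhi'⟩ := h1 j'
        have hjj : j' ≠ j := fun h => hl (by rw [h])
        have h3 := inner_le_of_mem_cone_of_mem_cone (hv j') (hvv j' j hjj) hc' hc
        have h4 := norm_add_sq_real (x (σ j')) ((t / ‖x (σ j)‖) • x (σ j))
        rw [real_inner_smul_right, htn] at h4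
        have h5 : t / ‖x (σ j)‖ * inner ℝ (x (σ j')) (x (σ j)) ≤ t * ‖x (σ j')‖ / 4 := by
          refine (mul_le_mul_of_nonneg_left h3 (div_nonneg (by linarith) hx0.le)).trans_eq ?_
          field_simp
        have h6 : t * ‖x (σ j')‖ ≤ s * r :=
          mul_le_mul (by linarith) (by linarith) (norm_nonneg _) hs.le
        have h7 : ‖x (σ j')‖ ^ 2 ≤ (r - s / 2) ^ 2 := pow_le_pow_left₀ (norm_nonneg _) hhi' 2
        have h8 : t ^ 2 ≤ s ^ 2 := pow_le_pow_left₀ (by linarith) (by linarith) 2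
        have h9 : s * s ≤ s * (r / 32) := mul_le_mul_of_nonneg_left hs' hs.le
        have h10 : 0 < s * r := by positivity
        refine lt_of_pow_lt_pow_left₀ 2 hr.le ?_
        nlinarith
      · have h3 := mem_closedBall_zero_iff.1 (h2 l hlr)
        have h4 := norm_add_le (x l) ((t / ‖x (σ j)‖) • x (σ j))
        linarith

/-! ### The two families of directions, and the case of three points -/

/-- The four coordinate directions. -/
noncomputable def squareDirection : Fin 4 → Plane :=
  ![!₂[1, 0], !₂[0, 1], !₂[-1, 0], !₂[0, -1]]

theorem norm_squareDirection (j : Fin 4) : ‖squareDirection j‖ = 1 := by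
  rw [← pow_left_inj₀ (norm_nonneg _) zero_le_one two_ne_zero]
  fin_cases j <;>
    simp [squareDirection, EuclideanSpace.norm_sq_eq, Fin.sum_univ_two]

theorem inner_squareDirection_nonpos (i j : Fin 4) (h : i ≠ j) :
    inner ℝ (squareDirection i) (squareDirection j) ≤ 0 := by
  fin_cases i <;> fin_cases j <;>
    simp [squareDirection, PiLp.inner_apply, Fin.sum_univ_two] at h ⊢

theorem inner_triangleDirection_nonpos (i j : Fin 3) (h : i ≠ j) :
    inner ℝ (triangleDirection i) (triangleDirection j) ≤ 0 := by
  fin_cases i <;> fin_cases j <;>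
    simp [triangleDirection, PiLp.inner_apply, Fin.sum_univ_two] at h ⊢ <;> norm_num

/-- The samples of three points of which the third is near the midpoint of the other two. -/
noncomputable def flatConfig (r : ℝ) : Set (Fin 3 → Plane) :=
  Set.univ.pi fun i => Metric.ball ((![r / 2, -(r / 2), 0] i : ℝ) • squareDirection 0) (r / 100)

theorem uniformSample_real_flatConfig_pos {r : ℝ} (hr : 0 < r) :
    0 < (uniformSample (Metric.closedBall (0 : Plane) r) 3).real (flatConfig r) := by
  rw [flatConfig, uniformSample_real_pi hr]
  refine Finset.prod_pos fun i _ => ?_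
  have hi : ‖(![r / 2, -(r / 2), 0] i : ℝ) • squareDirection 0‖ ≤ r / 2 := by
    rw [norm_smul, norm_squareDirection, mul_one]
    fin_cases i <;> (simp [abs_of_pos hr]; try positivity)
  rw [discLaw_real_of_subset]
  · refine div_pos (ENNReal.toReal_pos (Metric.measure_ball_pos _ _ (by positivity)).ne'
      measure_ball_lt_top.ne) ?_
    exact ENNReal.toReal_pos (Metric.measure_closedBall_pos _ _ hr).ne'
      measure_closedBall_lt_top.ne
  · refine Metric.ball_subset_closedBall.trans (Metric.closedBall_subset_closedBall' ?_)
    rw [dist_zero_right]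
    linarith

/-- The first two points are about r apart, so by the parallelogram law their midpoint is within
9r/10 of every centre. The third point is within r/50 of that midpoint and cannot lie on the circle.
-/
theorem vertexNumber_le_of_mem_flatConfig {r : ℝ} (hr : 0 < r) {x : Fin 3 → Plane}
    (hx : x ∈ flatConfig r) : vertexNumber r x ≤ 2 := by
  have h := vertexNumber_le_of_forall_mem hr three_pos (x := x) (T := {0, 1}) fun i hi => by
    by_contra hne
    have h2 : i = 2 := by
      fin_cases i
      · simp at hne
      · simp at hne
      · rfl
    subst h2
    obtain ⟨p, -, -, hp, -, h2p, -⟩ := hi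
    set e := squareDirection 0 with he
    have hen : ‖e‖ = 1 := norm_squareDirection 0
    have k0 := hx 0 (Set.mem_univ _)
    have k1 := hx 1 (Set.mem_univ _)
    have k2 := hx 2 (Set.mem_univ _)
    simp [dist_eq_norm, ← he] at k0 k1 k2
    have h0p := hp 0
    have h1p := hp 1
    rw [dist_eq_norm] at h0p h1p h2p
    have hpar := parallelogram_law_with_norm ℝ (x 0 - p) (x 1 - p)
    rw [sub_sub_sub_cancel_right] at hpar
    have hd : r - r / 50 ≤ ‖x 0 - x 1‖ := by
      have h3 : r • e = (x 0 - x 1) - (x 0 - (r / 2) • e) + (x 1 + (r / 2) • e) := by module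
      have h4 : ‖r • e‖ = r := by rw [norm_smul, hen, mul_one, Real.norm_of_nonneg hr.le]
      have h5 := norm_add_le ((x 0 - x 1) - (x 0 - (r / 2) • e)) (x 1 + (r / 2) • e)
      have h6 := norm_sub_le (x 0 - x 1) (x 0 - (r / 2) • e)
      rw [← h3, h4] at h5
      linarith
    have hm : ‖(x 0 - p) + (x 1 - p)‖ ≤ 9 / 5 * r := by
      refine le_of_sq_le_sq ?_ (by positivity)
      have := pow_le_pow_left₀ (by linarith) hd 2
      have := pow_le_pow_left₀ (norm_nonneg _) h0p 2
      have := pow_le_pow_left₀ (norm_nonneg _) h1p 2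
      nlinarith
    have h3 : (2 : ℝ) • (x 2 - p) = ((x 0 - p) + (x 1 - p)) - (x 0 - (r / 2) • e) -
        (x 1 + (r / 2) • e) + (2 : ℝ) • x 2 := by module
    have h4 := congrArg norm h3
    rw [norm_smul, h2p] at h4
    have h5 := norm_add_le (((x 0 - p) + (x 1 - p)) - (x 0 - (r / 2) • e) -
      (x 1 + (r / 2) • e)) ((2 : ℝ) • x 2)
    have h6 := norm_sub_le (((x 0 - p) + (x 1 - p)) - (x 0 - (r / 2) • e)) (x 1 + (r / 2) • e)
    have h7 := norm_sub_le ((x 0 - p) + (x 1 - p)) (x 0 - (r / 2) • e)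
    rw [norm_smul] at h5
    norm_num at h4 h5
    linarith
  simpa using h

theorem exists_le_variance_vertexNumber {r : ℝ} (hr : 0 < r) :
    ∃ c : ℝ, 0 < c ∧ ∀ n : ℕ, 3 ≤ n →
      c ≤ variance (vertexNumber r) (uniformSample (Metric.closedBall (0 : Plane) r) n) := by
  obtain ⟨c₃, hc₃, h₃⟩ := exists_le_uniformSample_real_cornerConfig hr three_pos
    norm_triangleDirection inner_triangleDirection_nonpos
  obtain ⟨c₄, hc₄, h₄⟩ := exists_le_uniformSample_real_cornerConfig hr four_pos
    norm_squareDirection inner_squareDirection_nonpos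
  set c₂ := (uniformSample (Metric.closedBall (0 : Plane) r) 3).real (flatConfig r) with h₂
  have hc₂ : 0 < c₂ := uniformSample_real_flatConfig_pos hr
  refine ⟨min c₂ (min c₃ c₄) / 4, by positivity, fun n hn => ?_⟩
  have := isProbabilityMeasure_uniformSample hr n
  have hn0 : 0 < n := by omega
  -- Three points cannot have four vertices, so for n = 3 the values 2 and 3 are separated instead
  -- of 3 and 4.
  rcases hn.eq_or_lt with rfl | hn4
  · refine le_variance_of_le_measureReal (m := 2) (memLp_vertexNumber hr hn0)
      ((min_le_left _ _).trans (measureReal_mono fun x hx => ?_))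
      (((min_le_right _ _).trans (min_le_left _ _)).trans ((h₃ 3 le_rfl).trans
        (measureReal_mono fun x hx => ?_)))
    · exact vertexNumber_le_of_mem_flatConfig hr hx
    · have := le_vertexNumber_of_mem_cornerConfig hr norm_triangleDirection
        inner_triangleDirection_nonpos hn0 hx
      show (2 : ℝ) + 1 ≤ vertexNumber r x
      push_cast at this
      linarith
  · refine le_variance_of_le_measureReal (m := 3) (memLp_vertexNumber hr hn0)
      (((min_le_right _ _).trans (min_le_left _ _)).trans ((h₃ n hn).trans
        (measureReal_mono fun x hx => ?_)))
      (((min_le_right _ _).trans (min_le_right _ _)).trans ((h₄ n hn4).trans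
        (measureReal_mono fun x hx => ?_)))
    · exact vertexNumber_le_of_mem_cornerConfig hr hn0 hx
    · have := le_vertexNumber_of_mem_cornerConfig hr norm_squareDirection
        inner_squareDirection_nonpos hn0 hx
      show (3 : ℝ) + 1 ≤ vertexNumber r x
      push_cast at this
      linarith

theorem theorem4 (r : ℝ) (hr : 0 < r) :
    (∃ c C : ℝ, 0 < c ∧ 0 < C ∧
      (∀ n : ℕ, 1 ≤ n →
        MemLp (vertexNumber r) 2 (uniformSample (Metric.closedBall (0 : Plane) r) n) ∧
        variance (vertexNumber r) (uniformSample (Metric.closedBall (0 : Plane) r) n) ≤ C) ∧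
      (∀ n : ℕ, 3 ≤ n →
        c ≤ variance (vertexNumber r) (uniformSample (Metric.closedBall (0 : Plane) r) n))) ∧
    (∃ C : ℝ, 0 < C ∧
      ∀ n : ℕ, 1 ≤ n →
        MemLp (polygonArea r) 2 (uniformSample (Metric.closedBall (0 : Plane) r) n) ∧
        variance (polygonArea r) (uniformSample (Metric.closedBall (0 : Plane) r) n)
          ≤ C * ((n : ℝ) ^ 2)⁻¹) := by
  obtain ⟨c, hc, hlow⟩ := exists_le_variance_vertexNumber hr
  obtain ⟨C, hC, hup⟩ := exists_variance_vertexNumber_le hr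
  obtain ⟨C', hC', hA⟩ := exists_variance_polygonArea_le hr
  exact ⟨⟨c, C, hc, hC, fun n hn => ⟨memLp_vertexNumber hr hn, hup n hn⟩, hlow⟩,
    C', hC', fun n hn => ⟨memLp_polygonArea hr hn, hA n hn⟩⟩
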